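/- Let $V$ be a set of $n\ge 1$ vertices and $\Delta\ge 1$ an integer. Starting from the empty graph on $V$, a sequence of $t$ updates (insertions of new edges, deletions of present edges), fixed in advance and such that all degrees always stay at most $\Delta$, is handled by the following randomized data structure, which maintains a coloring $\chi:V\to\mathcal C$ with $|\mathcal C|=\Delta+1$ and a level $\ell(v)\in\{-1,0,\dots,L\}$ for each $v\in V$, where $L=\lceil\log_3(n-1)\rceil-1$. Initially $\chi$ is arbitrary and all levels are $-1$. A deletion changes no color and no level. If an edge $uv$ with $\chi(u)=\chi(v)$ is inserted, let $x$ be the endpoint recolored last (ties broken arbitrarily) and repeat $x\leftarrow\mathtt{recolor}(x)$ until $x=\mathrm{NULL}$; other insertions change no color and no level. Let $\phi_x(k)$ be the number of neighbors of $x$ of level less than $k$; call a color blank for $x$ if no neighbor of $x$ has it, and unique for $x$ if exactly one neighbor of $x$ of level less than $\ell(x)$ and no neighbor of level at least $\ell(x)$ has it. $\mathtt{recolor}(x)$ does the following. * If $\phi_x(\ell(x)+1)<3^{\ell(x)+2}$, it gives $x$ a blank color, sets $\ell(x)\leftarrow -1$, and returns NULL. * Otherwise it sets $\ell(x)$ to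 the least $\ell'>\ell(x)$ with $\phi_x(\ell'+1)<3^{\ell'+2}$, then gives $x$ a color drawn uniformly at random from the colors that are blank or unique for $x$ (with respect to the new level); it returns the lower-level neighbor of $x$ that has this color if the color is unique, and NULL if it is blank. The data structure is implemented as follows. Each vertex $v$ has a linked list of its neighbors of level less than $\ell(v)$ (down-neighbors); an array of linked lists, indexed by levels, of its other neighbors (up-neighbors); counters of how many up-neighbors have each color; and an array, with a position table, of the colors that no up-neighbor has. There are also scratch counters indexed by colors. When the color or level of $x$ changes from level $\ell$ to level $\ell'$, the records of $x$ and of its neighbors of level at most $\max(\ell,\ell')$ are updated one neighbor at a time. Blank colors, and the colors of two or more down-neighbors, are found by first scanning the down-neighbors of $x$; a color is then drawn by one uniformly random array index after the colors of two or more down-neighbors have been temporarily taken out of the array. Each elementary operation (arithmetic, access to an array cell, insertion or pointer deletion in a linked list, appending or deletion in an array with a position table, draw of a random index) takes unit time, up to constant factors, and the preprocessing takes one unit for each initialized cell. Then there is an absolute constant $C$ such that, for all $n$, $\Delta$, initial colorings and update sequences as above, the total expected running time of the data structure (preprocessing included) is at most $$C\,(t+n\log n+\Delta n),$$ and its total running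 time is, deterministically, at most $$C\,(tn^2+n\log n+\Delta n).$$ -/

import Mathlib

open scoped ENNReal

namespace DynColor

/-- One update of the dynamic graph: insertion or deletion of the edge `uv`. -/
inductive Update (V : Type) where
  | ins (u v : V)
  | del (u v : V)

namespace Update

/-- The graph after the update. -/
def apply {V : Type} (G : SimpleGraph V) : Update V → SimpleGraph V
  | ins u v => G ⊔ SimpleGraph.edge u v
  | del u v => G.deleteEdges {s(u, v)}

/-- A new edge is inserted (between two distinct vertices), or a present edge is deleted. -/
def Legal {V : Type} (G : SimpleGraph V) : Update V → Prop
  | ins u v => u ≠ v ∧ ¬ G.Adj u v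
  | del u v => G.Adj u v

end Update

/-- `us` is a sequence of legal updates, starting from the graph `G`, such that after each of
them every vertex has degree at most `Δ`. -/
def Admissible {V : Type} (Δ : ℕ) : SimpleGraph V → List (Update V) → Prop
  | _, [] => True
  | G, a :: us => a.Legal G ∧ (∀ w, ((a.apply G).neighborSet w).ncard ≤ Δ) ∧
      Admissible Δ (a.apply G) us

/-- Number of levels `-1, 0, …, L`, where `L = ⌈log₃ (n - 1)⌉ - 1`. The level `ℓ` is represented by
the natural number `ℓ + 1` throughout, so that representatives are `0, …, ⌈log₃ (n - 1)⌉`. -/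
def numLevels (n : ℕ) : ℕ := Nat.clog 3 (n - 1) + 1

/-- Deletion of `a` from an array without repetitions: the last entry is moved to the position of
`a`, and the array is shortened by one entry. -/
def swapErase {α : Type} [DecidableEq α] (l : List α) (a : α) : List α :=
  match l.getLast? with
  | none => []
  | some b => if a ∈ l then (l.set (l.idxOf a) b).dropLast else l

/-- The memory of the data structure, for the vertex set `V` and the palette `{0, …, Δ}`.
Below, a step is one elementary operation: one arithmetic operation or comparison, one
read or write of an array cell, the insertion or (through a pointer) deletion of one element of a
doubly linked list that keeps its length, the appending or deletion of an entry of an array with a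
position table, or the draw of one uniformly random array index; a constant number of such
operations that are always executed together may be counted as one step. -/
structure Mem (V : Type) (Δ : ℕ) where
  /-- the colour `χ(v)` -/
  col : V → Fin (Δ + 1)
  /-- the level `ℓ(v)`, shifted by one -/
  lev : V → ℕ
  /-- the time of the last recolouring of `v`; zero if there was none -/
  stamp : V → ℕ
  /-- the number of recolourings so far -/
  clock : ℕ
  /-- linked list of the down-neighbours of `v` -/
  down : V → List V
  /-- `up v k` is the linked list of the up-neighbours of `v` whose shifted level is `k` -/
  up : V → ℕ → List V
  /-- the counter `μ⁺_v(c)`: the number of up-neighbours of `v` with colour `c` -/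
  upCount : V → Fin (Δ + 1) → ℕ
  /-- array (with a position table) of the colours that no up-neighbour of `v` has -/
  free : V → List (Fin (Δ + 1))
  /-- scratch counters, one for each colour, all zero between two recolourings -/
  seen : Fin (Δ + 1) → ℕ
  /-- the number of steps executed so far -/
  steps : ℕ

section Procedures

variable {V : Type} [DecidableEq V] {Δ : ℕ}

namespace Mem

/-- Count `k` steps. -/
def tick (s : Mem V Δ) (k : ℕ) : Mem V Δ := { s with steps := s.steps + k }

/-! Elementary operations, one step each. -/

def setCol (s : Mem V Δ) (v : V) (c : Fin (Δ + 1)) : Mem V Δ :=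
  { s with col := Function.update s.col v c, steps := s.steps + 1 }

def setLev (s : Mem V Δ) (v : V) (k : ℕ) : Mem V Δ :=
  { s with lev := Function.update s.lev v k, steps := s.steps + 1 }

/-- Record that `v` has just been recoloured. -/
def setStamp (s : Mem V Δ) (v : V) : Mem V Δ :=
  { s with
    stamp := Function.update s.stamp v (s.clock + 1)
    clock := s.clock + 1
    steps := s.steps + 1 }

def setDown (s : Mem V Δ) (v : V) (l : List V) : Mem V Δ :=
  { s with down := Function.update s.down v l, steps := s.steps + 1 }

def addDown (s : Mem V Δ) (v w : V) : Mem V Δ := s.setDown v (w :: s.down v)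

def delDown (s : Mem V Δ) (v w : V) : Mem V Δ := s.setDown v ((s.down v).erase w)

def setUp (s : Mem V Δ) (v : V) (k : ℕ) (l : List V) : Mem V Δ :=
  { s with
    up := Function.update s.up v (Function.update (s.up v) k l)
    steps := s.steps + 1 }

def addUp (s : Mem V Δ) (v : V) (k : ℕ) (w : V) : Mem V Δ := s.setUp v k (w :: s.up v k)

def delUp (s : Mem V Δ) (v : V) (k : ℕ) (w : V) : Mem V Δ := s.setUp v k ((s.up v k).erase w)

def setUpCount (s : Mem V Δ) (v : V) (c : Fin (Δ + 1)) (m : ℕ) : Mem V Δ :=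
  { s with
    upCount := Function.update s.upCount v (Function.update (s.upCount v) c m)
    steps := s.steps + 1 }

def setFree (s : Mem V Δ) (v : V) (l : List (Fin (Δ + 1))) : Mem V Δ :=
  { s with free := Function.update s.free v l, steps := s.steps + 1 }

def addFree (s : Mem V Δ) (v : V) (c : Fin (Δ + 1)) : Mem V Δ := s.setFree v (s.free v ++ [c])

def delFree (s : Mem V Δ) (v : V) (c : Fin (Δ + 1)) : Mem V Δ := s.setFree v (swapErase (s.free v) c)

def setSeen (s : Mem V Δ) (c : Fin (Δ + 1)) (m : ℕ) : Mem V Δ :=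
  { s with seen := Function.update s.seen c m, steps := s.steps + 1 }

/-! Maintenance of the neighbour lists and of the colour arrays. -/

/-- One more up-neighbour of `v` has colour `c`. -/
def incUp (s : Mem V Δ) (v : V) (c : Fin (Δ + 1)) : Mem V Δ :=
  let s₁ := s.setUpCount v c (s.upCount v c + 1)
  if s.upCount v c = 0 then s₁.delFree v c else s₁

/-- One up-neighbour of `v` with colour `c` less. -/
def decUp (s : Mem V Δ) (v : V) (c : Fin (Δ + 1)) : Mem V Δ :=
  let s₁ := s.setUpCount v c (s.upCount v c - 1)
  if s.upCount v c = 1 then s₁.addFree v c else s₁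

/-- Enter `w`, with its present level and colour, into the structures of its neighbour `v`. -/
def link (s : Mem V Δ) (v w : V) : Mem V Δ :=
  if s.lev w < s.lev v then s.addDown v w
  else (s.addUp v (s.lev w) w).incUp v (s.col w)

/-- Remove `w`, with its present level and colour, from the structures of its neighbour `v`. -/
def unlink (s : Mem V Δ) (v w : V) : Mem V Δ :=
  if s.lev w < s.lev v then s.delDown v w
  else (s.delUp v (s.lev w) w).decUp v (s.col w)

/-- The neighbours of `x` whose (shifted) level is at most `max (lev x) k`, read off from the
list of the down-neighbours and the lists of the up-neighbours. -/
def lowNbrs (s : Mem V Δ) (x : V) (k : ℕ) : List V :=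
  s.down x ++ (List.range' (s.lev x) (max (s.lev x) k + 1 - s.lev x)).flatMap (s.up x)

/-- Give `x` the (shifted) level `k` and the colour `c`, and update the structures of `x` and of
the neighbours of `x` in which the level or colour of `x` is recorded differently afterwards. The
first line counts the time for copying the lists of these neighbours. -/
def relocate (s : Mem V Δ) (x : V) (k : ℕ) (c : Fin (Δ + 1)) : Mem V Δ :=
  let R := s.lowNbrs x k
  let s₀ := s.tick (R.length + (max (s.lev x) k + 1 - s.lev x))
  let s₁ := R.foldl (fun s w => ((s.tick 1).unlink x w).unlink w x) s₀
  let s₂ := (s₁.setLev x k).setCol x c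
  R.foldl (fun s w => ((s.tick 1).link x w).link w x) s₂

/-- Count in `seen` how many down-neighbours of `x` have each colour. -/
def countDown (s : Mem V Δ) (x : V) : Mem V Δ :=
  (s.down x).foldl (fun s w => s.setSeen (s.col w) (s.seen (s.col w) + 1)) s

/-- Reset the counters in `seen`. -/
def clearDown (s : Mem V Δ) (x : V) : Mem V Δ :=
  (s.down x).foldl (fun s w => s.setSeen (s.col w) 0) s

/-- Scan the array `l` for the first colour `c` with `seen c = 0`. -/
def scanBlank (s : Mem V Δ) : List (Fin (Δ + 1)) → Mem V Δ × Option (Fin (Δ + 1))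
  | [] => (s.tick 1, none)
  | c :: l => if s.seen c = 0 then (s.tick 1, some c) else (s.tick 1).scanBlank l

/-- The procedure `det-color(x)`: choose a blank colour for `x` and move `x` to level `-1`. -/
def detColor (s : Mem V Δ) (x : V) : Mem V Δ :=
  let p := (s.countDown x).scanBlank (s.free x)
  ((p.1.clearDown x).relocate x 0 (p.2.getD (s.col x))).setStamp x

/-- The least (shifted) level `k' ≥ k` at which the number of neighbours of `x` of level at most `k'`
is less than `3 ^ (k' + 1)`, where `m` is this number for `k`. The first argument bounds the
number of rounds. -/
def findLevel (x : V) : ℕ → Mem V Δ → ℕ → ℕ → Mem V Δ × ℕ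
  | 0, s, k, _ => (s, k)
  | f + 1, s, k, m =>
      if m < 3 ^ (k + 1) then (s.tick 1, k)
      else findLevel x f (s.tick 1) (k + 1) (m + (s.up x (k + 1)).length)

/-- The number `φ_x(ℓ(x) + 1)` of neighbours of `x` of level at most `ℓ(x)`. -/
def phi (s : Mem V Δ) (x : V) : ℕ := (s.down x).length + (s.up x (s.lev x)).length

/-- First part of `rand-color(x)`: move `x` up to the least level `ℓ' > ℓ(x)` such that fewer
than `3 ^ (ℓ' + 2)` neighbours of `x` have level at most `ℓ'`. -/
def raise [Fintype V] (s : Mem V Δ) (x : V) : Mem V Δ :=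
  let p := findLevel x (numLevels (Fintype.card V)) s (s.lev x) (s.phi x)
  p.1.relocate x p.2 (s.col x)

/-- Second part of `rand-color(x)`: take the colours of two or more down-neighbours out of the
array `free x`, which then holds exactly the blank and the unique colours for `x`. The colours
taken out are returned. -/
def hide (s : Mem V Δ) (x : V) : Mem V Δ × List (Fin (Δ + 1)) :=
  (s.down x).foldl
    (fun p w =>
      if 2 ≤ p.1.seen (p.1.col w) ∧ p.1.col w ∈ p.1.free x then
        ((p.1.tick 1).delFree x (p.1.col w), p.1.col w :: p.2)
      else (p.1.tick 1, p.2))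
    (s, [])

/-- Last part of `rand-color(x)`, after the colour `c` has been drawn: put the colours `H` back,
search the down-neighbours of `x` for one with colour `c`, recolour `x`, and return that
down-neighbour, if there is one. -/
def finishRand (s : Mem V Δ) (H : List (Fin (Δ + 1))) (x : V) (c : Fin (Δ + 1)) :
    Mem V Δ × Option V :=
  let s₁ := H.foldl (fun s a => s.addFree x a) s
  let y := (s₁.down x).find? (fun w => s₁.col w = c)
  let s₂ := (s₁.tick ((s₁.down x).length + 1)).clearDown x
  (((s₂.relocate x (s₂.lev x) c)).setStamp x, y)

/-- The procedure `rand-color(x)`. The colour is drawn uniformly at random from the blank and the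
unique colours for `x`; the result is the unique down-neighbour of `x` with that colour, if any. -/
noncomputable def randColor [Fintype V] (s : Mem V Δ) (x : V) : PMF (Mem V Δ × Option V) :=
  let p := ((s.raise x).countDown x).hide x
  let palette := p.1.free x
  if h : 0 < palette.length then
    haveI : Nonempty (Fin palette.length) := ⟨⟨0, h⟩⟩
    (PMF.uniformOfFintype (Fin palette.length)).map
      fun i => (p.1.tick 1).finishRand p.2 x (palette.get i)
  else PMF.pure (p.1, none)

/-- The procedure `recolor(x)`. -/
noncomputable def recolor [Fintype V] (s : Mem V Δ) (x : V) : PMF (Mem V Δ × Option V) :=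
  if s.phi x < 3 ^ (s.lev x + 1) then PMF.pure ((s.tick 1).detColor x, none)
  else (s.tick 1).randColor x

/-- The part of the handling of an update that precedes the recolourings. The second component is
the vertex to be recoloured: for a conflicting insertion, the endpoint that was recoloured last. -/
def handle (s : Mem V Δ) : Update V → Mem V Δ × Option V
  | .ins u v =>
      let s₁ := ((s.tick 1).link u v).link v u
      (s₁, if s.col u = s.col v then some (if s.stamp v ≤ s.stamp u then u else v) else none)
  | .del u v => (((s.tick 1).unlink u v).unlink v u, none)

/-- The memory after the preprocessing, for the initial colouring `χ₀` of the empty graph. One step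
is counted for each cell that is initialized: four for each vertex, the heads of the lists
of up-neighbours for all levels, the counters, the array `free v` and its position table, the
scratch counters, and the clock. -/
def init [Fintype V] (χ₀ : V → Fin (Δ + 1)) : Mem V Δ where
  col := χ₀
  lev := fun _ => 0
  stamp := fun _ => 0
  clock := 0
  down := fun _ => []
  up := fun _ _ => []
  upCount := fun _ _ => 0
  free := fun _ => List.finRange (Δ + 1)
  seen := fun _ => 0
  steps := Fintype.card V * (4 + numLevels (Fintype.card V) + 3 * (Δ + 1)) + (Δ + 1) + 1

end Mem

end Procedures

/-- A configuration during the run: the memory, the vertex that has to be recoloured next (if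
any), and the updates that have not been handled yet. -/
structure Config (V : Type) (Δ : ℕ) where
  mem : Mem V Δ
  pending : Option V
  todo : List (Update V)

/-- One transition: one call of `recolor` if there is a vertex to be recoloured, otherwise the
beginning of the next update. A configuration without pending vertex and without updates is final. -/
noncomputable def Config.next {V : Type} [DecidableEq V] [Fintype V] {Δ : ℕ} (c : Config V Δ) :
    PMF (Config V Δ) :=
  match c.pending, c.todo with
  | some x, us => (c.mem.recolor x).map fun p => ⟨p.1, p.2, us⟩
  | none, a :: us => PMF.pure ⟨(c.mem.handle a).1, (c.mem.handle a).2, us⟩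
  | none, [] => PMF.pure c

/-- The law of the configuration after `k` transitions, for the initial colouring `χ₀` and the
(fixed in advance) update sequence `us`. -/
noncomputable def law {V : Type} [DecidableEq V] [Fintype V] {Δ : ℕ} (χ₀ : V → Fin (Δ + 1))
    (us : List (Update V)) : ℕ → PMF (Config V Δ)
  | 0 => PMF.pure ⟨Mem.init χ₀, none, us⟩
  | k + 1 => (law χ₀ us k).bind Config.next

/-- The expected total running time. The number of steps never decreases along a run, so by monotone
convergence the supremum is the expectation of the number of steps of the whole run (it is
infinite if the run fails to stop with positive probability). -/
noncomputable def expectedTime {V : Type} [DecidableEq V] [Fintype V] {Δ : ℕ}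
    (χ₀ : V → Fin (Δ + 1)) (us : List (Update V)) : ℝ≥0∞ :=
  ⨆ k : ℕ, ∑' c : Config V Δ, law χ₀ us k c * (c.mem.steps : ℝ≥0∞)

end DynColor

/-! All levels below are shifted by one. A deterministic call of `recolor` at level `ℓ` costs at
most `60 * 3 ^ ℓ`, a random one that reaches level `k` at most `130 * 3 ^ k`
(`Mem.Records.recolor_spec`). In the random case the palette has more than `3 ^ k / 2` colours:
minimality of `k` yields at least `3 ^ k` down-neighbours, the degree bound leaves more free colours
than down-neighbours, and at most half as many colours as down-neighbours are taken out.

Expected time. `Config.weight` adds to the steps, for each vertex, `910 * (Δ - 3 ^ lev)` and the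
amount `saved`, and is shown to be a supermartingale. The amount `saved` looks into the future,
which is legitimate because the updates are fixed in advance: it is what remains of `1040 * 3 ^ lev`
at the first coming insertion that would make the vertex pending, after each earlier insertion at it
has used up `12480`. Passing such an insertion raises the weight by at most `12480` per endpoint,
which is prepaid (`Config.weight_handle`). A recoloured vertex has the newest stamp, so it creates
no clash for any other vertex (`Config.Inv.weight_recolored`). A deterministic call is paid by the
saved amount of the pending vertex. A random call to level `k` is paid by the drop of `910 * (Δ - 3
^ lev)`; this also covers the next pending vertex, which lies below level `k`, and the new saved
amount of the recoloured vertex on average. For the latter, each coming insertion threatens only one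
colour, so the sum over all colours is at most of the order of an arithmetic progression
(`sum_threat_le`), and division by the palette size leaves a small multiple of `3 ^ k`.

Worst case. Within one update every random call raises a level, and a deterministic call ends the
chain. In `Config.detWeight` a rise from `ℓ` to `k` releases `195 * (3 ^ k - 3 ^ ℓ) ≥ 130 * 3 ^ k`,
and at most `195 * n ^ 2` is available for each update.

Properness of the colouring is not needed for either bound: of the returned vertex, only its lower
level matters. -/

set_option linter.unusedSectionVars false

namespace DynColor

namespace Mem

variable {V : Type} [DecidableEq V] {Δ : ℕ}

/-! ### Frame conditions -/

/-- `s'` agrees with `s` except for the neighbour records, and at most `k` steps were executed. -/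
structure Frame (s s' : Mem V Δ) (k : ℕ) : Prop where
  col : s'.col = s.col
  lev : s'.lev = s.lev
  stamp : s'.stamp = s.stamp
  clock : s'.clock = s.clock
  seen : s'.seen = s.seen
  steps : s'.steps ≤ s.steps + k

theorem Frame.trans {s s' s'' : Mem V Δ} {k l : ℕ} (h : Frame s s' k) (h' : Frame s' s'' l) :
    Frame s s'' (k + l) :=
  ⟨h'.col.trans h.col, h'.lev.trans h.lev, h'.stamp.trans h.stamp, h'.clock.trans h.clock,
    h'.seen.trans h.seen, by have := h.steps; have := h'.steps; omega⟩

theorem frame_tick (s : Mem V Δ) (k : ℕ) : Frame s (s.tick k) k :=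
  ⟨rfl, rfl, rfl, rfl, rfl, le_rfl⟩

theorem frame_link (s : Mem V Δ) (v w : V) : Frame s (s.link v w) 3 := by
  unfold link incUp
  constructor <;> (dsimp only; split_ifs) <;>
    simp [addDown, setDown, addUp, setUp, setUpCount, delFree, setFree]

theorem frame_unlink (s : Mem V Δ) (v w : V) : Frame s (s.unlink v w) 3 := by
  unfold unlink decUp
  constructor <;> (dsimp only; split_ifs) <;>
    simp [delDown, setDown, delUp, setUp, setUpCount, addFree, setFree]

theorem frame_foldl (f : Mem V Δ → V → Mem V Δ) (k : ℕ) (hf : ∀ s w, Frame s (f s w) k)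
    (R : List V) (s : Mem V Δ) : Frame s (R.foldl f s) (k * R.length) := by
  induction R generalizing s with
  | nil => exact ⟨rfl, rfl, rfl, rfl, rfl, le_rfl⟩
  | cons w R ih =>
    have := (hf s w).trans (ih (f s w))
    rwa [show k + k * R.length = k * (w :: R).length by simp; ring] at this

theorem frame_foldl_unlink (x : V) (R : List V) (s : Mem V Δ) :
    Frame s (R.foldl (fun s w => ((s.tick 1).unlink x w).unlink w x) s) (7 * R.length) :=
  frame_foldl _ 7
    (fun s w => ((frame_tick s 1).trans (frame_unlink _ x w)).trans (frame_unlink _ w x)) R s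

theorem frame_foldl_link (x : V) (R : List V) (s : Mem V Δ) :
    Frame s (R.foldl (fun s w => ((s.tick 1).link x w).link w x) s) (7 * R.length) :=
  frame_foldl _ 7
    (fun s w => ((frame_tick s 1).trans (frame_link _ x w)).trans (frame_link _ w x)) R s

/-! ### Deletion from an array -/

theorem swapErase_perm {α : Type} [DecidableEq α] {l : List α} {a : α} (h : a ∈ l) :
    (swapErase l a).Perm (l.erase a) := by
  rcases List.eq_nil_or_concat l with rfl | ⟨m, b, rfl⟩
  · simp at h
  · simp only [List.concat_eq_append] at h ⊢
    unfold swapErase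
    simp only [List.getLast?_append, List.getLast?_singleton, Option.some_or, if_pos h]
    by_cases ha : a ∈ m
    · have hi : m.idxOf a < m.length := List.idxOf_lt_length_of_mem ha
      rw [List.idxOf_append_of_mem ha, List.set_append_left _ _ hi, List.erase_append_left _ ha,
        List.dropLast_concat]
      rw [List.perm_iff_count]
      intro c
      have hc : m.count c = (m.erase a).count c + if a = c then 1 else 0 := by
        rw [List.count_erase]
        by_cases hac : a = c
        · subst hac
          have := List.count_pos_iff.2 ha
          simp; omega
        · simp [hac]
      rw [List.count_set hi, List.count_append, List.getElem_idxOf]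
      simp only [List.count_singleton, beq_iff_eq]
      have : a = c → 0 < m.count c := by rintro rfl; exact List.count_pos_iff.2 ha
      split_ifs at hc ⊢ <;> omega
    · have hb : a = b := by simpa [ha] using h
      subst hb
      rw [List.idxOf_append_of_notMem ha, List.erase_append_right _ ha]
      simp

/-! ### Correctness of the neighbour records -/

variable [Fintype V]

/-- The neighbour records of `s` hold exactly the ordered pairs in `E`: the vertex `w` is entered
into the structures of `v` if and only if `(v, w) ∈ E`. -/
structure Records (E : Finset (V × V)) (s : Mem V Δ) : Prop where
  down_nodup : ∀ v, (s.down v).Nodup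
  mem_down : ∀ v w, w ∈ s.down v ↔ (v, w) ∈ E ∧ s.lev w < s.lev v
  up_nodup : ∀ v k, (s.up v k).Nodup
  mem_up : ∀ v k w, w ∈ s.up v k ↔ (v, w) ∈ E ∧ s.lev w = k ∧ s.lev v ≤ k
  upCount_eq : ∀ v c, s.upCount v c =
    (Finset.univ.filter fun w => (v, w) ∈ E ∧ s.lev v ≤ s.lev w ∧ s.col w = c).card
  free_nodup : ∀ v, (s.free v).Nodup
  mem_free : ∀ v c, c ∈ s.free v ↔ s.upCount v c = 0

theorem Records.tick {E : Finset (V × V)} {s : Mem V Δ} (h : Records E s) (k : ℕ) :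
    Records E (s.tick k) :=
  ⟨h.1, h.2, h.3, h.4, h.5, h.6, h.7⟩

/-- Ordered pairs instead of edges make the state between the two halves of an edge update an
instance of the same invariant. -/
theorem Records.link {E : Finset (V × V)} {s : Mem V Δ} (h : Records E s) {v w : V}
    (hvw : (v, w) ∉ E) : Records (insert (v, w) E) (s.link v w) := by
  have hF := frame_link s v w
  unfold Mem.link at *
  split_ifs at * with hl
  · have hd : w ∉ s.down v := fun hw => hvw ((h.mem_down v w).1 hw).1
    refine ⟨?_, ?_, h.up_nodup, ?_, ?_, h.free_nodup, h.mem_free⟩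
    · intro v'
      have := h.down_nodup v'
      by_cases hv : v' = v
      · subst hv; simp [addDown, setDown, this, hd]
      · simpa [addDown, setDown, hv] using this
    · intro v' w'
      have := h.mem_down v' w'
      by_cases hv : v' = v
      · subst hv
        by_cases hw : w' = w
        · subst hw; simp [addDown, setDown, hl]
        · simpa [addDown, setDown, hw] using this
      · simpa [addDown, setDown, hv] using this
    · intro v' k w'
      have := h.mem_up v' k w'
      simp only [addDown, setDown, Finset.mem_insert, Prod.mk.injEq] at *
      rw [this]
      constructor
      · rintro ⟨a, b⟩; exact ⟨Or.inr a, b⟩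
      · rintro ⟨⟨rfl, rfl⟩ | a, b⟩
        · omega
        · exact ⟨a, b⟩
    · intro v' c
      simp only [addDown, setDown, Finset.mem_insert, Prod.mk.injEq]
      rw [h.upCount_eq]
      congr 1
      ext w'
      simp only [Finset.mem_filter, Finset.mem_univ, true_and]
      constructor
      · rintro ⟨a, b⟩; exact ⟨Or.inr a, b⟩
      · rintro ⟨⟨rfl, rfl⟩ | a, b⟩
        · omega
        · exact ⟨a, b⟩
  · have hle : s.lev v ≤ s.lev w := not_lt.1 hl
    set s' := (s.addUp v (s.lev w) w).incUp v (s.col w) with hs'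
    have hdown : s'.down = s.down := by
      rw [hs']; unfold incUp; dsimp only; split_ifs <;> rfl
    have hup : s'.up = Function.update s.up v
        (Function.update (s.up v) (s.lev w) (w :: s.up v (s.lev w))) := by
      rw [hs']; unfold incUp; dsimp only; split_ifs <;> rfl
    have hcount : s'.upCount = Function.update s.upCount v
        (Function.update (s.upCount v) (s.col w) (s.upCount v (s.col w) + 1)) := by
      rw [hs']; unfold incUp; dsimp only; split_ifs <;> rfl
    have hfree : s'.free = Function.update s.free v
        (if s.upCount v (s.col w) = 0 then swapErase (s.free v) (s.col w) else s.free v) := by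
      rw [hs']; unfold incUp; dsimp only
      have : (s.addUp v (s.lev w) w).upCount = s.upCount := rfl
      rw [this]
      split_ifs
      · rfl
      · simp [setUpCount, addUp, setUp]
    have hd : w ∉ s.up v (s.lev w) := fun hw => hvw ((h.mem_up v _ w).1 hw).1
    have hm : ∀ c, c ∈ s'.free v ↔ c ∈ s.free v ∧ c ≠ s.col w := by
      intro c
      rw [hfree, Function.update_self]
      split_ifs with h0
      · have hc := (h.mem_free v (s.col w)).2 h0
        rw [(swapErase_perm hc).mem_iff, (h.free_nodup v).mem_erase_iff, and_comm]
      · constructor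
        · intro hc
          refine ⟨hc, ?_⟩
          rintro rfl
          exact h0 ((h.mem_free v _).1 hc)
        · exact And.left
    refine ⟨?_, ?_, ?_, ?_, ?_, ?_, ?_⟩
    · rw [hdown]; exact h.down_nodup
    · intro v' w'
      rw [hdown, hF.lev, h.mem_down]
      simp only [Finset.mem_insert, Prod.mk.injEq]
      constructor
      · rintro ⟨a, b⟩; exact ⟨Or.inr a, b⟩
      · rintro ⟨⟨rfl, rfl⟩ | a, b⟩
        · omega
        · exact ⟨a, b⟩
    · intro v' k
      have := h.up_nodup v' k
      rw [hup]
      by_cases hv : v' = v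
      · subst hv
        by_cases hk : k = s.lev w
        · subst hk; simp [this, hd]
        · simp [hk, this]
      · simp [hv, this]
    · intro v' k w'
      have := h.mem_up v' k w'
      rw [hup, hF.lev]
      by_cases hv : v' = v
      · subst hv
        by_cases hk : k = s.lev w
        · subst hk
          by_cases hw : w' = w
          · subst hw; simp [hle]
          · simpa [hw] using this
        · by_cases hw : w' = w
          · subst hw
            simp only [Function.update_self, ne_eq, hk, not_false_eq_true, Function.update_of_ne]
            rw [this]
            constructor
            · rintro ⟨a, b, c⟩; exact absurd b.symm hk
            · rintro ⟨a, b, c⟩; exact absurd b.symm hk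
          · simpa [hk, hw] using this
      · simpa [hv] using this
    · intro v' c
      have := h.upCount_eq v' c
      rw [hcount, hF.lev, hF.col]
      by_cases hv : v' = v
      · subst hv
        by_cases hc : c = s.col w
        · subst hc
          simp only [Function.update_self]
          rw [this, ← Finset.card_insert_of_notMem (a := w) (by simp [hvw])]
          congr 1
          ext w'
          by_cases hw : w' = w
          · subst hw; simp [hle]
          · simp [hw]
        · simp only [Function.update_self, ne_eq, hc, not_false_eq_true, Function.update_of_ne]
          rw [this]
          congr 1
          ext w'
          by_cases hw : w' = w
          · subst hw; simp [Ne.symm hc]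
          · simp [hw]
      · simpa [hv] using this
    · intro v'
      have := h.free_nodup v'
      rw [hfree]
      by_cases hv : v' = v
      · subst hv
        rw [Function.update_self]
        split_ifs with h0
        · exact ((swapErase_perm ((h.mem_free _ _).2 h0)).nodup_iff).2 (this.erase _)
        · exact this
      · simpa [hv] using this
    · intro v' c
      by_cases hv : v' = v
      · subst hv
        rw [hm, hcount, Function.update_self, h.mem_free]
        by_cases hc : c = s.col w
        · subst hc; simp
        · simp [hc]
      · rw [hfree, hcount]
        simpa [hv] using h.mem_free v' c

theorem Records.unlink {E : Finset (V × V)} {s : Mem V Δ} (h : Records E s) {v w : V}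
    (hvw : (v, w) ∈ E) : Records (E.erase (v, w)) (s.unlink v w) := by
  have hF := frame_unlink s v w
  unfold Mem.unlink at *
  split_ifs at * with hl
  · refine ⟨?_, ?_, h.up_nodup, ?_, ?_, h.free_nodup, h.mem_free⟩
    · intro v'
      have := h.down_nodup v'
      by_cases hv : v' = v
      · subst hv; simp [delDown, setDown, this.erase]
      · simpa [delDown, setDown, hv] using this
    · intro v' w'
      have := h.mem_down v' w'
      by_cases hv : v' = v
      · subst hv
        by_cases hw : w' = w
        · subst hw; simp [delDown, setDown, (h.down_nodup v').mem_erase_iff]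
        · simpa [delDown, setDown, hw, (h.down_nodup v').mem_erase_iff] using this
      · simpa [delDown, setDown, hv] using this
    · intro v' k w'
      have := h.mem_up v' k w'
      simp only [delDown, setDown, Finset.mem_erase, ne_eq, Prod.mk.injEq] at *
      rw [this]
      constructor
      · rintro ⟨a, b⟩; refine ⟨⟨?_, a⟩, b⟩; rintro ⟨rfl, rfl⟩; omega
      · rintro ⟨⟨_, a⟩, b⟩
        exact ⟨a, b⟩
    · intro v' c
      simp only [delDown, setDown, Finset.mem_erase, ne_eq, Prod.mk.injEq]
      rw [h.upCount_eq]
      congr 1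
      ext w'
      simp only [Finset.mem_filter, Finset.mem_univ, true_and]
      constructor
      · rintro ⟨a, b⟩; refine ⟨⟨?_, a⟩, b⟩; rintro ⟨rfl, rfl⟩; omega
      · rintro ⟨⟨_, a⟩, b⟩
        exact ⟨a, b⟩
  · have hle : s.lev v ≤ s.lev w := not_lt.1 hl
    set s' := (s.delUp v (s.lev w) w).decUp v (s.col w) with hs'
    have hdown : s'.down = s.down := by
      rw [hs']; unfold decUp; dsimp only; split_ifs <;> rfl
    have hup : s'.up = Function.update s.up v
        (Function.update (s.up v) (s.lev w) ((s.up v (s.lev w)).erase w)) := by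
      rw [hs']; unfold decUp; dsimp only; split_ifs <;> rfl
    have hcount : s'.upCount = Function.update s.upCount v
        (Function.update (s.upCount v) (s.col w) (s.upCount v (s.col w) - 1)) := by
      rw [hs']; unfold decUp; dsimp only; split_ifs <;> rfl
    have hfree : s'.free = Function.update s.free v
        (if s.upCount v (s.col w) = 1 then s.free v ++ [s.col w] else s.free v) := by
      rw [hs']; unfold decUp; dsimp only
      have : (s.delUp v (s.lev w) w).upCount = s.upCount := rfl
      rw [this]
      split_ifs
      · rfl
      · simp [setUpCount, delUp, setUp]
    -- The vertex `w` itself is counted, so the truncated subtraction is exact, and the colour is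
    -- not yet in the array when it is appended.
    have hpos : s.upCount v (s.col w) ≠ 0 := by
      rw [h.upCount_eq]
      exact (Finset.card_pos.2 ⟨w, by simp [hvw, hle]⟩).ne'
    have hnf : s.col w ∉ s.free v := fun hc => hpos ((h.mem_free _ _).1 hc)
    refine ⟨?_, ?_, ?_, ?_, ?_, ?_, ?_⟩
    · rw [hdown]; exact h.down_nodup
    · intro v' w'
      rw [hdown, hF.lev, h.mem_down]
      simp only [Finset.mem_erase, ne_eq, Prod.mk.injEq]
      constructor
      · rintro ⟨a, b⟩; refine ⟨⟨?_, a⟩, b⟩; rintro ⟨rfl, rfl⟩; omega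
      · rintro ⟨⟨_, a⟩, b⟩
        exact ⟨a, b⟩
    · intro v' k
      have := h.up_nodup v' k
      rw [hup]
      by_cases hv : v' = v
      · subst hv
        by_cases hk : k = s.lev w
        · subst hk; simp [this.erase]
        · simp [hk, this]
      · simp [hv, this]
    · intro v' k w'
      have := h.mem_up v' k w'
      rw [hup, hF.lev]
      by_cases hv : v' = v
      · subst hv
        by_cases hk : k = s.lev w
        · subst hk
          by_cases hw : w' = w
          · subst hw; simp [(h.up_nodup _ _).mem_erase_iff]
          · simpa [hw, (h.up_nodup _ _).mem_erase_iff] using this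
        · by_cases hw : w' = w
          · subst hw
            simp only [Function.update_self, ne_eq, hk, not_false_eq_true, Function.update_of_ne]
            rw [this]
            constructor
            · rintro ⟨a, b, c⟩; exact absurd b.symm hk
            · rintro ⟨a, b, c⟩; exact absurd b.symm hk
          · simpa [hk, hw] using this
      · simpa [hv] using this
    · intro v' c
      have := h.upCount_eq v' c
      rw [hcount, hF.lev, hF.col]
      by_cases hv : v' = v
      · subst hv
        by_cases hc : c = s.col w
        · subst hc
          simp only [Function.update_self]
          rw [this, ← Finset.card_erase_of_mem (a := w) (by simp [hvw, hle])]
          congr 1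
          ext w'
          by_cases hw : w' = w
          · subst hw; simp
          · simp [hw]
        · simp only [Function.update_self, ne_eq, hc, not_false_eq_true, Function.update_of_ne]
          rw [this]
          congr 1
          ext w'
          by_cases hw : w' = w
          · subst hw; simp [Ne.symm hc]
          · simp [hw]
      · simpa [hv] using this
    · intro v'
      have := h.free_nodup v'
      rw [hfree]
      by_cases hv : v' = v
      · subst hv
        rw [Function.update_self]
        split_ifs with h0
        · rw [List.nodup_append]
          simp only [this, List.nodup_singleton, List.mem_singleton, true_and]
          rintro a ha b rfl rfl
          exact hnf ha
        · exact this
      · simpa [hv] using this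
    · intro v' c
      by_cases hv : v' = v
      · subst hv
        rw [hfree, hcount, Function.update_self, Function.update_self]
        have := h.mem_free v' c
        by_cases hc : c = s.col w
        · subst hc
          split_ifs with h1
          · simp [h1]
          · simp [hnf]; omega
        · split_ifs <;> simp [hc, this]
      · rw [hfree, hcount]
        simpa [hv] using h.mem_free v' c

/-! ### Moving a vertex -/

theorem Records.foldl_unlink {x : V} {R : List V} (hR : R.Nodup) (hx : x ∉ R)
    {E : Finset (V × V)} {s : Mem V Δ} (h : Records E s)
    (hE : ∀ w ∈ R, (x, w) ∈ E ∧ (w, x) ∈ E) :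
    Records (E.filter fun p => ¬ (p.1 = x ∧ p.2 ∈ R) ∧ ¬ (p.2 = x ∧ p.1 ∈ R))
      (R.foldl (fun s w => ((s.tick 1).unlink x w).unlink w x) s) := by
  induction R generalizing E s with
  | nil => simpa using h
  | cons w R ih =>
    simp only [List.nodup_cons, List.mem_cons, not_or] at hR hx
    have h1 := ((h.tick 1).unlink (hE w (by simp)).1).unlink (v := w) (w := x)
      (by simp [Ne.symm hx.1, (hE w (by simp)).2])
    have h2 := ih hR.2 hx.2 h1 (fun w' hw' => by
      have hne : w' ≠ w := by rintro rfl; exact hR.1 hw'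
      have hne' : w' ≠ x := by rintro rfl; exact hx.2 hw'
      have := hE w' (by simp [hw'])
      simp [hne, hne', this, hx.1])
    rw [List.foldl_cons]
    convert h2 using 1
    ext ⟨a, b⟩
    simp only [Finset.mem_filter, Finset.mem_erase, List.mem_cons, ne_eq, Prod.mk.injEq]
    tauto

theorem Records.foldl_link {x : V} {R : List V} (hR : R.Nodup) (hx : x ∉ R)
    {E : Finset (V × V)} {s : Mem V Δ} (h : Records E s)
    (hE : ∀ w ∈ R, (x, w) ∉ E ∧ (w, x) ∉ E) :
    Records (E ∪ Finset.univ.filter fun p => (p.1 = x ∧ p.2 ∈ R) ∨ (p.2 = x ∧ p.1 ∈ R))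
      (R.foldl (fun s w => ((s.tick 1).link x w).link w x) s) := by
  induction R generalizing E s with
  | nil => simpa using h
  | cons w R ih =>
    simp only [List.nodup_cons, List.mem_cons, not_or] at hR hx
    have h1 := ((h.tick 1).link (hE w (by simp)).1).link (v := w) (w := x)
      (by simp [Ne.symm hx.1, (hE w (by simp)).2])
    have h2 := ih hR.2 hx.2 h1 (fun w' hw' => by
      have hne : w' ≠ w := by rintro rfl; exact hR.1 hw'
      have hne' : w' ≠ x := by rintro rfl; exact hx.2 hw'
      have := hE w' (by simp [hw'])
      simp [hne, hne', this, hx.1])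
    rw [List.foldl_cons]
    convert h2 using 1
    ext ⟨a, b⟩
    simp only [Finset.mem_filter, Finset.mem_insert, Finset.mem_union, Finset.mem_univ, true_and,
      List.mem_cons, Prod.mk.injEq]
    tauto

/-- A neighbour strictly above both the old and the new level of `x` has `x` in its list of
down-neighbours before and after, where neither colour nor level is stored; for `x` it stays an
up-neighbour. Hence only the other neighbours have to be unlinked first. -/
theorem Records.setLev_setCol {E : Finset (V × V)} {s : Mem V Δ} (h : Records E s) {x : V}
    {k : ℕ} (hout : ∀ w, (x, w) ∈ E → w ≠ x ∧ s.lev x < s.lev w ∧ k < s.lev w)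
    (hin : ∀ w, (w, x) ∈ E → w ≠ x ∧ s.lev x < s.lev w ∧ k < s.lev w) (c : Fin (Δ + 1)) :
    Records E ((s.setLev x k).setCol x c) := by
  refine ⟨h.down_nodup, ?_, h.up_nodup, ?_, ?_, h.free_nodup, h.mem_free⟩
  · intro v w
    have h1 := h.mem_down v w
    simp only [setCol, setLev, h1, Function.update_apply]
    refine and_congr_right fun hE => ?_
    split_ifs with ha hb hb
    · subst ha hb; exact absurd rfl (hout _ hE).1
    · subst ha; have := hin _ hE; omega
    · subst hb; have := hout _ hE; omega
    · rfl
  · intro v j w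
    have h1 := h.mem_up v j w
    simp only [setCol, setLev, h1, Function.update_apply]
    refine and_congr_right fun hE => ?_
    split_ifs with ha hb hb
    · subst ha hb; exact absurd rfl (hout _ hE).1
    · subst ha; have := hin _ hE; omega
    · subst hb; have := hout _ hE; omega
    · rfl
  · intro v d
    have h1 := h.upCount_eq v d
    simp only [setCol, setLev, h1, Function.update_apply]
    congr 1
    ext w
    simp only [Finset.mem_filter, Finset.mem_univ, true_and]
    refine and_congr_right fun hE => ?_
    by_cases hb : w = x
    · subst hb
      have := hin _ hE
      simp only [if_neg this.1, if_true]
      omega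
    · simp only [if_neg hb]
      by_cases ha : v = x
      · subst ha
        have := hout _ hE
        simp only [if_true]
        constructor <;> rintro ⟨_, q⟩ <;> exact ⟨by omega, q⟩
      · simp only [if_neg ha]

/-! ### Counting neighbours by level, and the cost of a relocation -/

/-- The number of neighbours of `x`, with respect to the pairs in `E`, of level at most `k`. -/
def lowCount (E : Finset (V × V)) (s : Mem V Δ) (x : V) (k : ℕ) : ℕ :=
  (Finset.univ.filter fun w => (x, w) ∈ E ∧ s.lev w ≤ k).card

theorem Records.mem_lowNbrs {E : Finset (V × V)} {s : Mem V Δ} (h : Records E s) (x : V) (k : ℕ)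
    (w : V) : w ∈ s.lowNbrs x k ↔ (x, w) ∈ E ∧ s.lev w ≤ max (s.lev x) k := by
  unfold lowNbrs
  simp only [List.mem_append, h.mem_down, List.mem_flatMap, List.mem_range'_1, h.mem_up]
  constructor
  · rintro (⟨a, b⟩ | ⟨j, hj, a, b, c⟩)
    · exact ⟨a, by omega⟩
    · exact ⟨a, by omega⟩
  · rintro ⟨a, b⟩
    by_cases hl : s.lev w < s.lev x
    · exact Or.inl ⟨a, hl⟩
    · exact Or.inr ⟨s.lev w, by omega, a, rfl, by omega⟩

theorem Records.nodup_lowNbrs {E : Finset (V × V)} {s : Mem V Δ} (h : Records E s) (x : V)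
    (k : ℕ) : (s.lowNbrs x k).Nodup := by
  unfold lowNbrs
  rw [List.nodup_append]
  refine ⟨h.down_nodup x, ?_, ?_⟩
  · rw [List.nodup_flatMap]
    refine ⟨fun j _ => h.up_nodup x j, ?_⟩
    refine List.Pairwise.imp ?_ (List.nodup_range' (step := 1) (by simp))
    intro i j hij w hi hj
    exact hij (((h.mem_up x i w).1 hi).2.1.symm.trans ((h.mem_up x j w).1 hj).2.1)
  · rintro a ha b hb rfl
    simp only [List.mem_flatMap, List.mem_range'_1, h.mem_up, h.mem_down] at ha hb
    obtain ⟨j, hj, _, h1, h2⟩ := hb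
    omega

theorem length_eq_card_of_nodup {l : List V} (hl : l.Nodup) {p : V → Prop} [DecidablePred p]
    (h : ∀ w, w ∈ l ↔ p w) : l.length = (Finset.univ.filter p).card := by
  rw [← List.toFinset_card_of_nodup hl]
  congr 1
  ext w
  simp [h]

theorem Records.length_lowNbrs {E : Finset (V × V)} {s : Mem V Δ} (h : Records E s) (x : V)
    (k : ℕ) : (s.lowNbrs x k).length = lowCount E s x (max (s.lev x) k) :=
  length_eq_card_of_nodup (h.nodup_lowNbrs x k) (h.mem_lowNbrs x k)

theorem Records.length_down {E : Finset (V × V)} {s : Mem V Δ} (h : Records E s) (x : V) :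
    (s.down x).length = (Finset.univ.filter fun w => (x, w) ∈ E ∧ s.lev w < s.lev x).card :=
  length_eq_card_of_nodup (h.down_nodup x) (h.mem_down x)

theorem Records.length_down_le {E : Finset (V × V)} {s : Mem V Δ} (h : Records E s) (x : V) :
    (s.down x).length ≤ lowCount E s x (s.lev x) := by
  rw [h.length_down]
  exact Finset.card_le_card fun w => by simp; intro a b; exact ⟨a, b.le⟩

theorem Records.phi_eq {E : Finset (V × V)} {s : Mem V Δ} (h : Records E s) (x : V) :
    s.phi x = lowCount E s x (s.lev x) := by
  have := h.length_lowNbrs x (s.lev x)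
  rw [max_self] at this
  rw [← this]
  simp [phi, lowNbrs]

theorem Records.lowCount_succ {E : Finset (V × V)} {s : Mem V Δ} (h : Records E s) {x : V}
    {k : ℕ} (hk : s.lev x ≤ k) :
    lowCount E s x k + (s.up x (k + 1)).length = lowCount E s x (k + 1) := by
  have h1 := h.length_lowNbrs x k
  have h2 := h.length_lowNbrs x (k + 1)
  rw [max_eq_right (by omega)] at h1 h2
  rw [← h1, ← h2]
  unfold lowNbrs
  rw [max_eq_right (by omega), max_eq_right (by omega),
    show k + 1 + 1 - s.lev x = (k + 1 - s.lev x) + 1 by omega, List.range'_concat]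
  simp only [one_mul, List.flatMap_append, List.length_append, List.flatMap_singleton]
  rw [show s.lev x + (k + 1 - s.lev x) = k + 1 by omega]
  ring

/-- The vertex `x` of `s` has got the level `k` and the colour `c` in `s'`, in at most `m` steps. -/
structure Moved (E : Finset (V × V)) (s s' : Mem V Δ) (x : V) (k : ℕ) (c : Fin (Δ + 1))
    (m : ℕ) : Prop where
  records : Records E s'
  lev : s'.lev = Function.update s.lev x k
  col : s'.col = Function.update s.col x c
  stamp : s'.stamp = s.stamp
  clock : s'.clock = s.clock
  seen : s'.seen = s.seen
  steps : s'.steps ≤ s.steps + m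

/-- For each affected neighbour, one step pays for copying, seven for unlinking both directions and
seven for linking them again. -/
theorem Records.moved_relocate {E : Finset (V × V)} {s : Mem V Δ} (h : Records E s)
    (hsymm : ∀ v w, (v, w) ∈ E → (w, v) ∈ E) (hirr : ∀ v, (v, v) ∉ E) (x : V) (k : ℕ)
    (c : Fin (Δ + 1)) :
    Moved E s (s.relocate x k c) x k c
      (15 * lowCount E s x (max (s.lev x) k) + (max (s.lev x) k + 1 - s.lev x) + 2) := by
  have hm := h.mem_lowNbrs x k
  have hn := h.nodup_lowNbrs x k
  have hlen := h.length_lowNbrs x k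
  unfold relocate
  set R := s.lowNbrs x k
  have hx : x ∉ R := fun hx => hirr x ((hm x).1 hx).1
  extract_lets R' s₀ s₁ s₂
  have hrec₁ : Records (E.filter fun p => ¬ (p.1 = x ∧ p.2 ∈ R) ∧ ¬ (p.2 = x ∧ p.1 ∈ R)) s₁ :=
    Records.foldl_unlink hn hx (h.tick _) fun w hw =>
    ⟨((hm w).1 hw).1, hsymm _ _ ((hm w).1 hw).1⟩
  have hF₁ : Frame s s₁ _ := (frame_tick s _).trans (frame_foldl_unlink x R s₀)
  have hout : ∀ w, (x, w) ∈ E → w ∉ R → w ≠ x ∧ s.lev x < s.lev w ∧ k < s.lev w := by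
    intro w hw hR
    refine ⟨?_, ?_⟩
    · rintro rfl; exact hirr _ hw
    · have : ¬ s.lev w ≤ max (s.lev x) k := fun hle => hR ((hm w).2 ⟨hw, hle⟩)
      omega
  have hrec₂ : Records _ s₂ := hrec₁.setLev_setCol (x := x) (k := k)
    (fun w hw => by
      rw [hF₁.lev]
      simp only [Finset.mem_filter] at hw
      exact hout w hw.1 fun hR => hw.2.1 ⟨trivial, hR⟩)
    (fun w hw => by
      rw [hF₁.lev]
      simp only [Finset.mem_filter] at hw
      exact hout w (hsymm _ _ hw.1) fun hR => hw.2.2 ⟨trivial, hR⟩) c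
  have hrec₃ := hrec₂.foldl_link hn hx fun w hw => by simp [hw]
  have hF₃ := frame_foldl_link x R' s₂
  refine ⟨?_, ?_, ?_, ?_, ?_, ?_, ?_⟩
  · convert hrec₃ using 1
    ext ⟨a, b⟩
    simp only [Finset.mem_union, Finset.mem_filter, Finset.mem_univ, true_and]
    constructor
    · tauto
    · rintro (⟨h1, _⟩ | ⟨rfl, h1⟩ | ⟨rfl, h1⟩)
      · exact h1
      · exact ((hm _).1 h1).1
      · exact hsymm _ _ ((hm _).1 h1).1
  · rw [hF₃.lev]
    change Function.update s₁.lev x k = _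
    rw [hF₁.lev]
  · rw [hF₃.col]
    change Function.update s₁.col x c = _
    rw [hF₁.col]
  · rw [hF₃.stamp]; exact hF₁.stamp
  · rw [hF₃.clock]; exact hF₁.clock
  · rw [hF₃.seen]; exact hF₁.seen
  · have e1 := hF₁.steps
    have e3 := hF₃.steps
    have e2 : s₂.steps = s₁.steps + 1 + 1 := rfl
    have e4 : R'.length = R.length := rfl
    omega

/-! ### Scratch counters -/

theorem foldl_count (l : List V) (s : Mem V Δ) :
    l.foldl (fun s w => s.setSeen (s.col w) (s.seen (s.col w) + 1)) s =
      { s with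
        seen := fun c => s.seen c + l.countP fun w => s.col w = c
        steps := s.steps + l.length } := by
  induction l generalizing s with
  | nil => simp
  | cons w l ih =>
    rw [List.foldl_cons, ih]
    simp only [setSeen, Mem.mk.injEq, List.length_cons, true_and]
    refine ⟨?_, by omega⟩
    funext c
    rw [List.countP_cons]
    by_cases hc : c = s.col w
    · subst hc; simp [add_assoc, add_comm]; exact Nat.add_left_comm _ _ _
    · simp [Ne.symm hc, Function.update_of_ne hc]; rfl

theorem foldl_clear (l : List V) (s : Mem V Δ) :
    l.foldl (fun s w => s.setSeen (s.col w) 0) s =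
      { s with
        seen := fun c => if ∃ w ∈ l, s.col w = c then 0 else s.seen c
        steps := s.steps + l.length } := by
  induction l generalizing s with
  | nil => simp
  | cons w l ih =>
    rw [List.foldl_cons, ih]
    simp only [setSeen, Mem.mk.injEq, List.length_cons, true_and]
    refine ⟨?_, by omega⟩
    funext c
    by_cases hc : c = s.col w
    · subst hc; simp
    · simp [hc, Ne.symm hc]

theorem countDown_eq (s : Mem V Δ) (hs : s.seen = fun _ => 0) (x : V) :
    s.countDown x =
      { s with
        seen := fun c => (s.down x).countP fun w => s.col w = c
        steps := s.steps + (s.down x).length } := by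
  unfold countDown
  rw [foldl_count]
  simp [hs]

theorem clearDown_eq (s : Mem V Δ) (x : V)
    (hs : s.seen = fun c => (s.down x).countP fun w => s.col w = c) :
    s.clearDown x =
      { s with
        seen := fun _ => 0
        steps := s.steps + (s.down x).length } := by
  unfold clearDown
  rw [foldl_clear]
  simp only [Mem.mk.injEq, true_and, and_true]
  funext c
  rw [hs]
  split_ifs with h
  · rfl
  · push Not at h
    simpa using h

/-- Every step of the scan but the last is charged to a colour with nonzero counter. -/
theorem scanBlank_eq (l : List (Fin (Δ + 1))) (s : Mem V Δ) :
    ∃ j, (s.scanBlank l).1 = s.tick j ∧ j ≤ (l.filter fun c => s.seen c ≠ 0).length + 1 := by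
  induction l generalizing s with
  | nil => exact ⟨1, rfl, by simp⟩
  | cons c l ih =>
    unfold scanBlank
    split_ifs with hc
    · exact ⟨1, rfl, by simp⟩
    · obtain ⟨j, h1, h2⟩ := ih (s.tick 1)
      refine ⟨j + 1, ?_, ?_⟩
      · rw [h1]; simp [tick]; ring
      · rw [List.filter_cons_of_pos (by simpa using hc)]
        exact Nat.succ_le_succ h2

/-- A list of `D.length` vertices has at most `D.length` colours. -/
theorem length_filter_countP_le {l : List (Fin (Δ + 1))} (hl : l.Nodup) (D : List V)
    (col : V → Fin (Δ + 1)) :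
    (l.filter fun c => (D.countP fun w => col w = c) ≠ 0).length ≤ D.length := by
  rw [← List.length_map (f := col) (as := D)]
  refine List.Subperm.length_le ((hl.filter _).subperm ?_)
  intro c hc
  simp only [List.mem_filter, ne_eq, List.countP_eq_zero, decide_eq_true_eq, not_forall, not_not] at hc
  obtain ⟨_, w, hw, h⟩ := hc
  exact List.mem_map.2 ⟨w, hw, h⟩

/-! ### Deterministic recolouring -/

/-- The outcome of one recolouring: the vertex `x` has got the level `k` and the colour `c`. -/
structure Recolored (E : Finset (V × V)) (s s' : Mem V Δ) (x : V) (k : ℕ)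
    (c : Fin (Δ + 1)) : Prop where
  records : Records E s'
  lev : s'.lev = Function.update s.lev x k
  col : s'.col = Function.update s.col x c
  stamp : s'.stamp = Function.update s.stamp x (s.clock + 1)
  clock : s'.clock = s.clock + 1
  seen : s'.seen = fun _ => 0

theorem Records.recolored_relocate {E : Finset (V × V)} {s : Mem V Δ} (h : Records E s)
    (hsymm : ∀ v w, (v, w) ∈ E → (w, v) ∈ E) (hirr : ∀ v, (v, v) ∉ E)
    (hs : s.seen = fun _ => 0) (x : V) (k : ℕ) (c : Fin (Δ + 1)) :
    Recolored E s ((s.relocate x k c).setStamp x) x k c ∧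
      ((s.relocate x k c).setStamp x).steps ≤ s.steps +
        (15 * lowCount E s x (max (s.lev x) k) + (max (s.lev x) k + 1 - s.lev x) + 3) := by
  have hM := h.moved_relocate hsymm hirr x k c
  have hr := hM.records
  refine ⟨⟨⟨hr.1, hr.2, hr.3, hr.4, hr.5, hr.6, hr.7⟩, hM.lev, hM.col, ?_, ?_, ?_⟩, ?_⟩
  · change Function.update (s.relocate x k c).stamp x ((s.relocate x k c).clock + 1) = _
    rw [hM.stamp, hM.clock]
  · change (s.relocate x k c).clock + 1 = _
    rw [hM.clock]
  · exact hM.seen.trans hs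
  · change (s.relocate x k c).steps + 1 ≤ _
    have e := hM.steps
    omega

theorem Records.recolored_detColor {E : Finset (V × V)} {s : Mem V Δ} (h : Records E s)
    (hsymm : ∀ v w, (v, w) ∈ E → (w, v) ∈ E) (hirr : ∀ v, (v, v) ∉ E)
    (hs : s.seen = fun _ => 0) (x : V) :
    ∃ c, Recolored E s (s.detColor x) x 0 c ∧
      (s.detColor x).steps ≤ s.steps + 18 * s.phi x + 5 := by
  unfold detColor
  obtain ⟨j, hj, hj'⟩ := scanBlank_eq (s.free x) (s.countDown x)
  extract_lets p
  have hp : p.1 = _ := hj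
  refine ⟨p.2.getD (s.col x), ?_⟩
  -- The cost is independent of the colour, so it is not needed that the scan succeeds.
  generalize p.2.getD (s.col x) = c
  rw [countDown_eq s hs] at hj'
  have hj2 := hj'.trans (Nat.succ_le_succ (length_filter_countP_le (h.free_nodup x) _ _))
  have hcl : p.1.clearDown x = { s with
      seen := fun _ => 0
      steps := s.steps + (s.down x).length + j + (s.down x).length } := by
    rw [hp, countDown_eq s hs, clearDown_eq _ _ rfl]
    rfl
  rw [hcl]
  set s₁ : Mem V Δ := { s with
      seen := fun _ => 0
      steps := s.steps + (s.down x).length + j + (s.down x).length } with hs₁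
  have hrec : Records E s₁ := ⟨h.1, h.2, h.3, h.4, h.5, h.6, h.7⟩
  obtain ⟨hM, hst⟩ := hrec.recolored_relocate hsymm hirr rfl x 0 c
  have hD := h.length_down_le x
  refine ⟨⟨hM.1, hM.2, hM.3, hM.4, hM.5, hM.6⟩, ?_⟩
  have e1 : s₁.steps = s.steps + (s.down x).length + j + (s.down x).length := rfl
  have e2 : lowCount E s₁ x (max (s₁.lev x) 0) = lowCount E s x (s.lev x) := by
    rw [max_eq_left (Nat.zero_le _)]; rfl
  have e3 : max (s₁.lev x) 0 + 1 - s₁.lev x = 1 := by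
    rw [max_eq_left (Nat.zero_le _)]; omega
  rw [h.phi_eq]
  rw [e2, e3] at hst
  omega

/-! ### Random recolouring -/

/-- The hypothesis `hb` says that the test succeeds in the last permitted round at the latest, so
the search never ends by exhausting its rounds. The last conclusion is the failure of the test one
level below. -/
theorem Records.findLevel_spec {E : Finset (V × V)} (x : V) (f : ℕ) {s : Mem V Δ}
    (h : Records E s) {k : ℕ} (hk : s.lev x ≤ k) (hf : 0 < f)
    (hb : lowCount E s x (k + f - 1) < 3 ^ (k + f)) :
    ∃ j k', findLevel x f s k (lowCount E s x k) = (s.tick j, k') ∧ j ≤ k' - k + 1 ∧ k ≤ k' ∧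
      lowCount E s x k' < 3 ^ (k' + 1) ∧ (k < k' → 3 ^ k' ≤ lowCount E s x (k' - 1)) := by
  induction f generalizing s k with
  | zero => omega
  | succ f ih =>
    unfold findLevel
    split_ifs with hm
    · exact ⟨1, k, rfl, by omega, le_rfl, hm, fun hlt => absurd hlt (lt_irrefl _)⟩
    · rcases Nat.eq_zero_or_pos f with rfl | hf'
      · exact absurd hb hm
      · obtain ⟨j, k', h1, h2, h3, h4, h5⟩ := ih (h.tick 1) (k := k + 1)
          (by change s.lev x ≤ _; omega) hf' (by
            rw [show k + 1 + f - 1 = k + (f + 1) - 1 by omega,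
              show k + 1 + f = k + (f + 1) by omega]
            exact hb)
        rw [h.lowCount_succ hk]
        refine ⟨1 + j, k', ?_, by omega, by omega, h4, fun _ => ?_⟩
        · rw [show s.tick (1 + j) = (s.tick 1).tick j by simp only [Mem.tick, Nat.add_assoc]]
          exact h1
        · rcases Nat.lt_or_ge (k + 1) k' with hlt | hge
          · exact h5 hlt
          · obtain rfl : k' = k + 1 := by omega
            exact not_lt.1 hm

theorem lowCount_lt {E : Finset (V × V)} (hirr : ∀ v, (v, v) ∉ E) (s : Mem V Δ) (x : V) (k : ℕ) :
    lowCount E s x k < Fintype.card V := by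
  unfold lowCount
  refine Finset.card_lt_univ_of_notMem (x := x) ?_
  simp [hirr x]

theorem lowCount_update_lev {E : Finset (V × V)} (hirr : ∀ v, (v, v) ∉ E) {s s' : Mem V Δ}
    {x : V} {j : ℕ} (h : s'.lev = Function.update s.lev x j) (k : ℕ) :
    lowCount E s' x k = lowCount E s x k := by
  unfold lowCount
  congr 1
  ext w
  simp only [Finset.mem_filter, Finset.mem_univ, true_and, h]
  refine and_congr_right fun hE => ?_
  rw [Function.update_of_ne]
  rintro rfl
  exact hirr _ hE

theorem Records.moved_raise {E : Finset (V × V)} {s : Mem V Δ} (h : Records E s)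
    (hsymm : ∀ v w, (v, w) ∈ E → (w, v) ∈ E) (hirr : ∀ v, (v, v) ∉ E) {x : V}
    (hphi : 3 ^ (s.lev x + 1) ≤ s.phi x) :
    ∃ k, s.lev x < k ∧ lowCount E s x k < 3 ^ (k + 1) ∧ 3 ^ k ≤ lowCount E s x (k - 1) ∧
      Moved E s (s.raise x) x k (s.col x) (15 * lowCount E s x k + 2 * k + 4) := by
  -- A vertex has at most `n - 1` neighbours, and `n - 1` is at most 3 to the power `numLevels n -
  -- 1`.
  have hb : lowCount E s x (s.lev x + numLevels (Fintype.card V) - 1) <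
      3 ^ (s.lev x + numLevels (Fintype.card V)) := by
    have h1 := lowCount_lt hirr s x (s.lev x + numLevels (Fintype.card V) - 1)
    have h2 : Fintype.card V - 1 ≤ 3 ^ Nat.clog 3 (Fintype.card V - 1) :=
      Nat.le_pow_clog (by norm_num) _
    have h3 : 3 ^ Nat.clog 3 (Fintype.card V - 1) < 3 ^ (s.lev x + numLevels (Fintype.card V)) :=
      Nat.pow_lt_pow_right (by norm_num) (by unfold numLevels; omega)
    omega
  obtain ⟨j, k, h1, h2, h3, h4, h5⟩ := h.findLevel_spec x _ le_rfl (by simp [numLevels]) hb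
  rw [h.phi_eq] at hphi
  have hlt : s.lev x < k := by
    rcases h3.lt_or_eq with hlt | rfl
    · exact hlt
    · omega
  have hr : s.raise x = (s.tick j).relocate x k (s.col x) := by
    unfold raise
    rw [h.phi_eq, h1]
  have hM := (h.tick j).moved_relocate hsymm hirr x k (s.col x)
  refine ⟨k, hlt, h4, h5 hlt, ?_⟩
  rw [hr]
  refine ⟨hM.1, hM.2, hM.3, hM.4, hM.5, hM.6, ?_⟩
  have e := hM.steps
  have e1 : (s.tick j).lev = s.lev := rfl
  have e2 : (s.tick j).steps = s.steps + j := rfl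
  have e3 : lowCount E (s.tick j) x k = lowCount E s x k := rfl
  rw [e1, max_eq_right hlt.le, e2, e3] at e
  omega

theorem foldl_addFree (x : V) (H : List (Fin (Δ + 1))) (s : Mem V Δ) :
    H.foldl (fun s a => s.addFree x a) s =
      { s with
        free := Function.update s.free x (s.free x ++ H)
        steps := s.steps + H.length } := by
  induction H generalizing s with
  | nil => simp
  | cons a H ih =>
    rw [List.foldl_cons, ih]
    simp only [addFree, setFree, Mem.mk.injEq, List.length_cons, true_and, Function.update_self,
      Function.update_idem, List.append_assoc, List.singleton_append]
    omega

/-- The array and the list of removed colours together remain a permutation of the original; this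
gives both the palette size and the restoration of the array afterwards. -/
theorem foldl_hide (x : V) (l : List V) (s : Mem V Δ) (H : List (Fin (Δ + 1)))
    (hnd : (s.free x ++ H).Nodup) :
    ∃ F H' m, l.foldl (fun p w =>
      if 2 ≤ p.1.seen (p.1.col w) ∧ p.1.col w ∈ p.1.free x then
        ((p.1.tick 1).delFree x (p.1.col w), p.1.col w :: p.2)
      else (p.1.tick 1, p.2)) (s, H) =
        ({ s with free := Function.update s.free x F, steps := s.steps + m }, H') ∧
      m ≤ 2 * l.length ∧ (F ++ H').Perm (s.free x ++ H) ∧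
      ∀ c ∈ H', c ∈ H ∨ 2 ≤ s.seen c := by
  induction l generalizing s H with
  | nil => exact ⟨s.free x, H, 0, by simp, by simp, List.Perm.refl _, fun c hc => Or.inl hc⟩
  | cons w l ih =>
    rw [List.foldl_cons]
    dsimp only
    split_ifs with hc
    · set s' := (s.tick 1).delFree x (s.col w) with hs'
      have hfree : s'.free x = swapErase (s.free x) (s.col w) := by
        simp [hs', delFree, setFree, tick]
      have hp : (s'.free x ++ s.col w :: H).Perm (s.free x ++ H) := by
        rw [hfree]
        refine ((swapErase_perm hc.2).append_right _).trans ?_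
        refine List.perm_middle.trans ?_
        rw [← List.cons_append]
        exact (List.perm_cons_erase hc.2).symm.append_right _
      obtain ⟨F, H', m, h1, h2, h3, h4⟩ := ih s' (s.col w :: H) (hp.nodup_iff.2 hnd)
      refine ⟨F, H', 1 + (1 + m), ?_, by simp; omega, h3.trans hp, ?_⟩
      · rw [h1]
        simp only [hs', delFree, setFree, tick, Function.update_idem, add_assoc]
      · intro c hcH
        rcases h4 c hcH with h | h
        · rcases List.mem_cons.1 h with rfl | h
          · exact Or.inr hc.1
          · exact Or.inl h
        · exact Or.inr h
    · obtain ⟨F, H', m, h1, h2, h3, h4⟩ := ih (s.tick 1) H hnd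
      refine ⟨F, H', 1 + m, ?_, by simp; omega, h3, h4⟩
      rw [h1]
      simp [tick, add_assoc]

/-- At most half as many colours as there are vertices in `D` can occur twice in `D`. -/
theorem two_mul_length_le {H : List (Fin (Δ + 1))} (hH : H.Nodup) (D : List V)
    (col : V → Fin (Δ + 1)) (h : ∀ c ∈ H, 2 ≤ D.countP fun w => col w = c) :
    2 * H.length ≤ D.length := by
  have h1 : 2 * H.length = ∑ c ∈ H.toFinset, 2 := by
    rw [Finset.sum_const, List.toFinset_card_of_nodup hH, smul_eq_mul, mul_comm]
  have h2 : ∑ c ∈ H.toFinset, 2 ≤ ∑ c ∈ H.toFinset, (D.map col).count c := by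
    refine Finset.sum_le_sum fun c hc => ?_
    have := h c (List.mem_toFinset.1 hc)
    have e : ((· == c) ∘ col) = fun w => decide (col w = c) := by
      funext w; exact beq_eq_decide _ _
    rw [List.count, List.countP_map, e]
    exact this
  have h3 : ∑ c ∈ H.toFinset, (D.map col).count c ≤ ∑ c, (D.map col).count c :=
    Finset.sum_le_sum_of_subset (Finset.subset_univ _)
  have h4 : ∑ c, (D.map col).count c = D.length := by
    have := Multiset.sum_count_eq_card (s := Finset.univ)
      (m := ((D.map col : List (Fin (Δ + 1))) : Multiset (Fin (Δ + 1)))) (fun a _ => Finset.mem_univ a)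
    simpa using this
  omega

/-- Each colour missing from the array is the colour of some up-neighbour. -/
theorem Records.length_free {E : Finset (V × V)} {s : Mem V Δ} (h : Records E s) (x : V) :
    Δ + 1 ≤ (s.free x).length +
      (Finset.univ.filter fun w => (x, w) ∈ E ∧ s.lev x ≤ s.lev w).card := by
  have h1 : (Finset.univ : Finset (Fin (Δ + 1))) ⊆ (s.free x).toFinset ∪
      (Finset.univ.filter fun w => (x, w) ∈ E ∧ s.lev x ≤ s.lev w).image s.col := by
    intro c _
    simp only [Finset.mem_union, List.mem_toFinset, Finset.mem_image, Finset.mem_filter,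
      Finset.mem_univ, true_and, h.mem_free, h.upCount_eq, Finset.card_eq_zero]
    by_contra! hc
    obtain ⟨w, hw⟩ := hc.1
    simp only [Finset.mem_filter, Finset.mem_univ, true_and] at hw
    exact hc.2 w ⟨hw.1, hw.2.1⟩ hw.2.2
  have h2 := (Finset.card_le_card h1).trans (Finset.card_union_le _ _)
  rw [Finset.card_univ, Fintype.card_fin, List.toFinset_card_of_nodup (h.free_nodup x)] at h2
  exact h2.trans (Nat.add_le_add_left Finset.card_image_le _)

/-- The number of neighbours of `x` with respect to the pairs in `E`. -/
def degree (E : Finset (V × V)) (x : V) : ℕ := (Finset.univ.filter fun w => (x, w) ∈ E).card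

theorem lowCount_le_degree (E : Finset (V × V)) (s : Mem V Δ) (x : V) (k : ℕ) :
    lowCount E s x k ≤ degree E x :=
  Finset.card_le_card fun w => by simp; intro a _; exact a

theorem Records.with_free {E : Finset (V × V)} {s : Mem V Δ} (h : Records E s) {x : V}
    {L : List (Fin (Δ + 1))} (hL : L.Perm (s.free x)) (seen : Fin (Δ + 1) → ℕ) (m : ℕ) :
    Records E { s with free := Function.update s.free x L, seen := seen, steps := m } := by
  refine ⟨h.1, h.2, h.3, h.4, h.5, fun v => ?_, fun v c => ?_⟩
  · by_cases hv : v = x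
    · subst hv; simpa using hL.nodup_iff.2 (h.6 v)
    · simpa [hv] using h.6 v
  · by_cases hv : v = x
    · subst hv; simpa [hL.mem_iff] using h.7 v c
    · simpa [hv] using h.7 v c

theorem randColor_eq (s : Mem V Δ) (x : V) {q : Mem V Δ × List (Fin (Δ + 1))}
    (hq : ((s.raise x).countDown x).hide x = q) (hpos : 0 < (q.1.free x).length) :
    s.randColor x =
      (haveI : Nonempty (Fin (q.1.free x).length) := ⟨⟨0, hpos⟩⟩
      (PMF.uniformOfFintype (Fin (q.1.free x).length)).map
        fun i => (q.1.tick 1).finishRand q.2 x ((q.1.free x).get i)) := by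
  subst hq
  exact dif_pos hpos

/-- If `x` is recoloured at random and gets the level `k`, then the palette of the random draw has
more than `3 ^ k / 2` colours, and every draw leads to a recolouring at a cost of `O(3 ^ k)`. -/
theorem Records.randColor_spec {E : Finset (V × V)} {s : Mem V Δ} (h : Records E s)
    (hsymm : ∀ v w, (v, w) ∈ E → (w, v) ∈ E) (hirr : ∀ v, (v, v) ∉ E)
    (hs : s.seen = fun _ => 0) {x : V} (hphi : 3 ^ (s.lev x + 1) ≤ s.phi x)
    (hdeg : degree E x ≤ Δ) :
    ∃ (k : ℕ) (P : List (Fin (Δ + 1))) (f : Fin (Δ + 1) → Mem V Δ × Option V)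
      (_ : Nonempty (Fin P.length)),
      s.randColor x =
        (PMF.uniformOfFintype (Fin P.length)).map (fun i => f (P.get i)) ∧
      P.Nodup ∧ 3 ^ k + 2 ≤ 2 * P.length ∧ s.lev x < k ∧ 3 ^ k ≤ degree E x ∧
      ∀ c, Recolored E s (f c).1 x k c ∧ (f c).1.steps ≤ s.steps + 129 * 3 ^ k ∧
        ∀ y, (f c).2 = some y → y ≠ x ∧ s.lev y < k := by
  obtain ⟨k, hk, hlow, hge, hM⟩ := h.moved_raise hsymm hirr hphi
  have hr := hM.records
  have hseen := hM.seen.trans hs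
  set s₁ := s.raise x with hs₁
  set D := s₁.down x with hD
  have hcount := countDown_eq s₁ hseen x
  have hlev : s₁.lev x = k := by rw [hM.lev]; simp
  have hlc : lowCount E s₁ x k = lowCount E s x k := lowCount_update_lev hirr hM.lev k
  have hDle : D.length ≤ lowCount E s x k := by
    have := hr.length_down_le x
    rwa [hlev, hlc] at this
  -- After the rise, the down-neighbours are all the neighbours of level at most `k - 1`; these are
  -- at least `3 ^ k` because the search did not stop at `k - 1`.
  have hDge : 3 ^ k ≤ D.length := by
    rw [hD, hr.length_down, hlev]
    refine hge.trans (le_of_eq ?_)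
    rw [← lowCount_update_lev hirr hM.lev]
    unfold lowCount
    congr 1
    ext w
    simp only [Finset.mem_filter, Finset.mem_univ, true_and]
    exact and_congr_right fun _ => by omega
  obtain ⟨F, H, m, hh, hm, hperm, hH⟩ := foldl_hide x D (s₁.countDown x) [] (by
    rw [hcount, List.append_nil]; exact hr.free_nodup x)
  rw [hcount] at hh hperm hH
  simp only [List.append_nil, List.not_mem_nil, false_or] at hh hperm hH
  have hhide : (s₁.countDown x).hide x =
      ({ s₁ with
        seen := fun c => D.countP fun w => s₁.col w = c
        free := Function.update s₁.free x F
        steps := s₁.steps + D.length + m }, H) := by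
    rw [← hh, hcount]
    rfl
  have hndFH : (F ++ H).Nodup := hperm.nodup_iff.2 (hr.free_nodup x)
  have hH2 := two_mul_length_le (List.nodup_append.1 hndFH).2.1 D s₁.col hH
  have hFH := hperm.length_eq
  rw [List.length_append] at hFH
  have hfree := hr.length_free x
  have hdegree : D.length +
      (Finset.univ.filter fun w => (x, w) ∈ E ∧ s₁.lev x ≤ s₁.lev w).card = degree E x := by
    rw [hD, hr.length_down, degree, ← Finset.card_union_of_disjoint]
    · congr 1
      ext w
      simp only [Finset.mem_union, Finset.mem_filter, Finset.mem_univ, true_and]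
      constructor
      · tauto
      · intro hw
        rcases lt_or_ge (s₁.lev w) (s₁.lev x) with hl | hl
        · exact Or.inl ⟨hw, hl⟩
        · exact Or.inr ⟨hw, hl⟩
    · rw [Finset.disjoint_left]
      intro w
      simp only [Finset.mem_filter, Finset.mem_univ, true_and]
      intro a b
      omega
  -- The array had at least `|D| + 1` colours by the degree bound, and `2 * |H| ≤ |D|`; so `2 * |F|
  -- ≥ |D| + 2`, which also yields the claimed palette size.
  have hpos : 0 < F.length := by omega
  set s₂ : Mem V Δ := { s₁ with
        seen := fun c => D.countP fun w => s₁.col w = c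
        free := Function.update s₁.free x F
        steps := s₁.steps + D.length + m } with hs₂
  have hF : s₂.free x = F := by simp [hs₂]
  refine ⟨k, s₂.free x, fun c => (s₂.tick 1).finishRand H x c, ⟨⟨0, hF ▸ hpos⟩⟩, ?_,
    hF ▸ (List.nodup_append.1 hndFH).1, by rw [hF]; omega, hk, hge.trans (lowCount_le_degree _ _ _ _), ?_⟩
  · exact randColor_eq s x hhide (hF ▸ hpos)
  · intro c
    beta_reduce
    generalize hq : (s₂.tick 1).finishRand H x c = q
    unfold finishRand at hq
    extract_lets s₃ y s₄ at hq
    subst hq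
    have hs₃ : s₃ = { s₁ with
        seen := fun c => D.countP fun w => s₁.col w = c
        free := Function.update s₁.free x (F ++ H)
        steps := s₁.steps + D.length + m + 1 + H.length } := by
      simp only [s₃, foldl_addFree, hs₂, Mem.tick, Function.update_self, Function.update_idem]
    have hs₄ : s₄ = { s₁ with
        seen := fun _ => 0
        free := Function.update s₁.free x (F ++ H)
        steps := s₁.steps + D.length + m + 1 + H.length + (D.length + 1) + D.length } := by
      simp only [s₄]
      rw [clearDown_eq, hs₃]
      · rfl
      · rw [hs₃]; rfl
    have hr₄ : Records E s₄ := by rw [hs₄]; exact hr.with_free hperm _ _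
    have hlev₄ : s₄.lev = s₁.lev := by rw [hs₄]
    obtain ⟨hR, hst⟩ := hr₄.recolored_relocate hsymm hirr (by rw [hs₄]) x (s₄.lev x) c
    have hl₄ : s₄.lev x = k := by rw [hlev₄, hlev]
    have hlc₄ : lowCount E s₄ x k = lowCount E s x k :=
      lowCount_update_lev hirr (hlev₄.trans hM.lev) k
    rw [hl₄] at hR hst
    rw [max_self, hlc₄] at hst
    have hst₄ : s₄.steps =
        s₁.steps + D.length + m + 1 + H.length + (D.length + 1) + D.length := by rw [hs₄]
    rw [hl₄]
    refine ⟨⟨hR.records, ?_, ?_, ?_, ?_, hR.seen⟩, ?_, ?_⟩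
    · rw [hR.lev, hlev₄, hM.lev, Function.update_idem]
    · rw [hR.col, hs₄]
      change Function.update s₁.col x c = _
      rw [hM.col, Function.update_idem]
    · rw [hR.stamp, hs₄]
      change Function.update s₁.stamp x (s₁.clock + 1) = _
      rw [hM.stamp, hM.clock]
    · rw [hR.clock, hs₄]
      change s₁.clock + 1 = _
      rw [hM.clock]
    · have e := hM.steps
      have e2 : k < 3 ^ k := Nat.lt_pow_self (by norm_num)
      -- The two relocations dominate with `30 * lowCount`, the scans add fewer than `6 * |D|`, and
      -- both counts are below `3 * 3 ^ k`.
      have e3 : 3 ^ (k + 1) = 3 * 3 ^ k := by ring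
      refine hst.trans ?_
      rw [hst₄]
      omega
    · intro z hz
      have hz' : z ∈ s₁.down x := by
        have := List.mem_of_find?_eq_some hz
        rwa [hs₃] at this
      rw [hr.mem_down] at hz'
      have hne : z ≠ x := by rintro rfl; exact hirr _ hz'.1
      refine ⟨hne, ?_⟩
      have := hz'.2
      rwa [hlev, hM.lev, Function.update_of_ne hne] at this

end Mem

/-! ### Expectations -/

section Expectation

variable {α β : Type}

theorem tsum_pure_mul (a : α) (f : α → ℝ≥0∞) : ∑' b, PMF.pure a b * f b = f a := by
  rw [tsum_eq_single a]
  · simp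
  · intro b hb
    simp [PMF.pure_apply, hb]

theorem tsum_bind_mul (p : PMF α) (q : α → PMF β) (f : β → ℝ≥0∞) :
    ∑' b, p.bind q b * f b = ∑' a, p a * ∑' b, q a b * f b := by
  simp_rw [PMF.bind_apply, ← ENNReal.tsum_mul_right, ← ENNReal.tsum_mul_left, mul_assoc]
  exact ENNReal.tsum_comm

theorem tsum_map_mul (p : PMF α) (g : α → β) (f : β → ℝ≥0∞) :
    ∑' b, p.map g b * f b = ∑' a, p a * f (g a) := by
  rw [← PMF.bind_pure_comp, tsum_bind_mul]
  simp_rw [Function.comp, tsum_pure_mul]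

theorem tsum_uniform_mul_le [Fintype α] [Nonempty α] (f : α → ℝ≥0∞) {m : ℝ≥0∞}
    (h : ∑ a, f a ≤ Fintype.card α * m) :
    ∑' a, PMF.uniformOfFintype α a * f a ≤ m := by
  rw [tsum_fintype]
  simp_rw [PMF.uniformOfFintype_apply]
  rw [← Finset.mul_sum]
  calc _ ≤ (Fintype.card α : ℝ≥0∞)⁻¹ * (Fintype.card α * m) := by gcongr
    _ = m := by
      rw [← mul_assoc, ENNReal.inv_mul_cancel (by simp) (by simp), one_mul]

end Expectation

/-! ### Future insertions at a vertex -/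

section Threat

variable {V : Type}

open Classical in
/-- The part of the budget `h` that is left when the first of the coming insertions at `x` whose
other endpoint satisfies `q` is reached, if every insertion at `x` before uses up `12480` units;
zero if there is no such insertion. -/
noncomputable def threat (x : V) (q : V → Prop) : List (Update V) → ℕ → ℕ
  | [], _ => 0
  | .del _ _ :: us, h => threat x q us h
  | .ins u v :: us, h =>
      if u = x then if q v then h else threat x q us (h - 12480)
      else if v = x then if q u then h else threat x q us (h - 12480)
      else threat x q us h

open Classical in
theorem threat_ins (x : V) (q : V → Prop) (u v : V) (us : List (Update V)) (h : ℕ) :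
    threat x q (.ins u v :: us) h =
      if u = x then if q v then h else threat x q us (h - 12480)
      else if v = x then if q u then h else threat x q us (h - 12480)
      else threat x q us h := rfl

theorem threat_le (x : V) (q : V → Prop) (us : List (Update V)) (h : ℕ) :
    threat x q us h ≤ h := by
  induction us generalizing h with
  | nil => simp [threat]
  | cons a us ih =>
    cases a with
    | del u v => exact ih h
    | ins u v =>
      have h1 := ih (h - 12480)
      have h2 := ih h
      rw [threat_ins]
      split_ifs <;> omega

theorem threat_mono (x : V) {q q' : V → Prop} (hq : ∀ w, q w → q' w) (us : List (Update V))
    (h : ℕ) : threat x q us h ≤ threat x q' us h := by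
  induction us generalizing h with
  | nil => simp [threat]
  | cons a us ih =>
    cases a with
    | del u v => exact ih h
    | ins u v =>
      have h1 := ih (h - 12480)
      have h2 := ih h
      have h3 := threat_le x q us (h - 12480)
      rw [threat_ins, threat_ins]
      split_ifs <;> first | omega | (exfalso; simp_all)

/-- This bounds the price of passing one harmless insertion at `x`: the budget is restored from `h -
12480` to `h`. -/
theorem threat_le_add (x : V) (q : V → Prop) (us : List (Update V)) (h : ℕ) :
    threat x q us h ≤ threat x q us (h - 12480) + 12480 := by
  induction us generalizing h with
  | nil => simp [threat]
  | cons a us ih =>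
    cases a with
    | del u v => exact ih h
    | ins u v =>
      have h1 := ih (h - 12480)
      have h2 := ih h
      rw [threat_ins, threat_ins]
      split_ifs <;> omega

/-- The other endpoint of an insertion at `x` has only one colour. So each such insertion
contributes its current budget for at most one `c`, and the budgets `h`, `h - 12480`, ... form an
arithmetic progression. The bound is a convenient majorant of its sum. -/
theorem sum_threat_le {α : Type} [DecidableEq α] (x : V) (col : V → α) (us : List (Update V))
    (h : ℕ) (S : Finset α) :
    24960 * ∑ c ∈ S, threat x (fun w => col w = c) us h ≤ h * (h + 24960) := by
  induction us generalizing h S with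
  | nil => simp [threat]
  | cons a us ih =>
    have key : ∀ w, 24960 * ∑ c ∈ S, (if col w = c then h else
        threat x (fun w => col w = c) us (h - 12480)) ≤ h * (h + 24960) := by
      intro w
      have h1 : ∑ c ∈ S, (if col w = c then h else
          threat x (fun w => col w = c) us (h - 12480)) ≤
          h + ∑ c ∈ S, threat x (fun w => col w = c) us (h - 12480) := by
        calc _ ≤ ∑ c ∈ S, ((if col w = c then h else 0) +
              threat x (fun w => col w = c) us (h - 12480)) := by
              refine Finset.sum_le_sum fun c _ => ?_
              split_ifs <;> omega
          _ ≤ _ := by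
              rw [Finset.sum_add_distrib, Finset.sum_ite_eq]
              split_ifs <;> omega
      have h2 := ih (h - 12480) S
      -- As `24960 = 2 * 12480`, the second product is `h ^ 2 - 12480 ^ 2`, unless the subtraction
      -- is truncated and it vanishes.
      have h3 : 24960 * h + (h - 12480) * (h - 12480 + 24960) ≤ h * (h + 24960) := by
        rcases le_total 12480 h with hh | hh
        · obtain ⟨d, rfl⟩ := Nat.exists_eq_add_of_le hh
          rw [Nat.add_sub_cancel_left]
          nlinarith
        · rw [Nat.sub_eq_zero_of_le hh]
          nlinarith
      calc _ ≤ 24960 * (h + ∑ c ∈ S, threat x (fun w => col w = c) us (h - 12480)) :=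
            Nat.mul_le_mul_left _ h1
        _ ≤ _ := by rw [mul_add]; omega
    cases a with
    | del u v => exact ih h S
    | ins u v =>
      simp only [threat_ins]
      by_cases hu : u = x
      · simp only [if_pos hu]
        convert key v
      · by_cases hv : v = x
        · simp only [if_neg hu, if_pos hv]
          convert key u
        · simp only [if_neg hu, if_neg hv]
          exact ih h S

end Threat

/-! ### Invariant and potential functions -/

variable {V : Type} [DecidableEq V] [Fintype V] {Δ : ℕ}

open Classical in
/-- The ordered pairs of adjacent vertices. -/
noncomputable def pairs (G : SimpleGraph V) : Finset (V × V) :=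
  Finset.univ.filter fun p => G.Adj p.1 p.2

@[simp] theorem mem_pairs {G : SimpleGraph V} {v w : V} : (v, w) ∈ pairs G ↔ G.Adj v w := by
  simp [pairs]

theorem degree_pairs (G : SimpleGraph V) (v : V) :
    Mem.degree (pairs G) v = (G.neighborSet v).ncard := by
  unfold Mem.degree
  rw [← Set.ncard_coe_finset]
  congr 1
  ext w
  simp

theorem degree_lt {E : Finset (V × V)} (hirr : ∀ v, (v, v) ∉ E) (x : V) :
    Mem.degree E x < Fintype.card V := by
  unfold Mem.degree
  refine Finset.card_lt_univ_of_notMem (x := x) ?_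
  simp [hirr x]

/-- The invariant of the configurations that occur while the graph is `G`. -/
structure Config.Inv (G : SimpleGraph V) (c : Config V Δ) : Prop where
  records : Mem.Records (pairs G) c.mem
  seen : c.mem.seen = fun _ => 0
  stamp : ∀ v, c.mem.stamp v ≤ c.mem.clock
  lev_le : ∀ v, 3 ^ c.mem.lev v ≤ Δ
  lev_le_card : ∀ v, 3 ^ c.mem.lev v ≤ Fintype.card V
  degree_le : ∀ v, Mem.degree (pairs G) v ≤ Δ
  todo : Admissible Δ G c.todo

/-- An insertion of the edge `xw` would make `x` the vertex to be recoloured, up to ties. -/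
def Mem.Clash (s : Mem V Δ) (x w : V) : Prop :=
  w ≠ x ∧ s.col w = s.col x ∧ s.stamp w ≤ s.stamp x

/-- The amount saved for the next termination of the present period of `x`. -/
noncomputable def Config.saved (c : Config V Δ) (x : V) : ℕ :=
  if c.pending = some x then 1040 * 3 ^ c.mem.lev x
  else threat x (c.mem.Clash x) c.todo (1040 * 3 ^ c.mem.lev x)

/-- The potential function for the expected running time. -/
noncomputable def Config.weight (c : Config V Δ) : ℕ :=
  c.mem.steps + ∑ x, (910 * (Δ - 3 ^ c.mem.lev x) + c.saved x) +
    (if c.pending.isSome then 60 else 0) + 25027 * c.todo.length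

/-- The potential function for the worst-case running time. -/
def Config.detWeight (c : Config V Δ) : ℕ :=
  c.mem.steps +
    (if c.pending.isSome then
      60 * Fintype.card V + 195 * ∑ x, (Fintype.card V - 3 ^ c.mem.lev x) else 0) +
    (7 + 60 * Fintype.card V + 195 * Fintype.card V ^ 2) * c.todo.length

/-! ### Updates -/

theorem Mem.frame_handle (s : Mem V Δ) (a : Update V) : Mem.Frame s (s.handle a).1 7 := by
  cases a with
  | ins u v => exact ((frame_tick s 1).trans (frame_link _ u v)).trans (frame_link _ v u)
  | del u v => exact ((frame_tick s 1).trans (frame_unlink _ u v)).trans (frame_unlink _ v u)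

theorem Mem.Records.handle {G : SimpleGraph V} {s : Mem V Δ} (h : Mem.Records (pairs G) s)
    {a : Update V} (ha : a.Legal G) : Mem.Records (pairs (a.apply G)) (s.handle a).1 := by
  cases a with
  | ins u v =>
    obtain ⟨hne, hadj⟩ := ha
    have h1 := ((h.tick 1).link (v := u) (w := v) (by simpa using hadj)).link (v := v) (w := u)
      (by simp [hne.symm, G.adj_comm v u, hadj])
    refine Eq.subst (motive := fun E => Mem.Records E _) ?_ h1
    ext ⟨p, q⟩
    simp only [mem_pairs, Update.apply, SimpleGraph.sup_adj, SimpleGraph.edge_adj,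
      Finset.mem_insert, Prod.mk.injEq]
    constructor
    · rintro (⟨rfl, rfl⟩ | ⟨rfl, rfl⟩ | h2)
      · exact Or.inr ⟨Or.inr ⟨rfl, rfl⟩, hne.symm⟩
      · exact Or.inr ⟨Or.inl ⟨rfl, rfl⟩, hne⟩
      · exact Or.inl h2
    · tauto
  | del u v =>
    have hadj : G.Adj u v := ha
    have h1 := ((h.tick 1).unlink (v := u) (w := v) (by simpa using hadj)).unlink (v := v) (w := u)
      (by simp [hadj.ne, hadj.symm])
    refine Eq.subst (motive := fun E => Mem.Records E _) ?_ h1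
    ext ⟨p, q⟩
    simp only [mem_pairs, Update.apply, SimpleGraph.deleteEdges_adj, Set.mem_singleton_iff,
      Sym2.eq_iff, Finset.mem_erase, ne_eq, Prod.mk.injEq]
    tauto

theorem Config.Inv.handle {G : SimpleGraph V} {s : Mem V Δ} {a : Update V} {us : List (Update V)}
    (h : Config.Inv G ⟨s, none, a :: us⟩) :
    Config.Inv (a.apply G) ⟨(s.handle a).1, (s.handle a).2, us⟩ := by
  have hF := s.frame_handle a
  obtain ⟨ha, hd, hus⟩ := h.todo
  refine ⟨h.records.handle ha, hF.seen.trans h.seen, ?_, ?_, ?_, ?_, hus⟩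
  · intro v; rw [hF.stamp, hF.clock]; exact h.stamp v
  · intro v; rw [hF.lev]; exact h.lev_le v
  · intro v; rw [hF.lev]; exact h.lev_le_card v
  · intro v; rw [degree_pairs]; exact hd v

/-- The price `25027 = 7 + 60 + 2 * 12480` of an update covers its steps, the bonus for a pending
vertex and the restored budgets of both endpoints. -/
theorem Config.weight_handle {G : SimpleGraph V} {s : Mem V Δ} {a : Update V}
    {us : List (Update V)} (ha : a.Legal G) :
    Config.weight ⟨(s.handle a).1, (s.handle a).2, us⟩ ≤
      Config.weight (⟨s, none, a :: us⟩ : Config V Δ) := by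
  have hF := s.frame_handle a
  have hclash : ∀ x, (s.handle a).1.Clash x = s.Clash x := by
    intro x; funext w; simp only [Mem.Clash, hF.col, hF.stamp]
  have key : ∃ u v : V, ∀ x, Config.saved ⟨(s.handle a).1, (s.handle a).2, us⟩ x ≤
      Config.saved (⟨s, none, a :: us⟩ : Config V Δ) x +
        ((if u = x then 12480 else 0) + (if v = x then 12480 else 0)) := by
    cases a with
    | del u v =>
      refine ⟨u, v, fun x => ?_⟩
      simp only [Config.saved, hclash, hF.lev, reduceCtorEq, if_false]
      have : (s.handle (.del u v)).2 = none := rfl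
      simp only [this, reduceCtorEq, if_false, threat]
      omega
    | ins u v =>
      have hne : u ≠ v := ha.1
      refine ⟨u, v, fun x => ?_⟩
      have hp : (s.handle (.ins u v)).2 =
        if s.col u = s.col v then some (if s.stamp v ≤ s.stamp u then u else v) else none := rfl
      simp only [Config.saved, hclash, hF.lev, reduceCtorEq, if_false]
      rw [hp]
      set h := 1040 * 3 ^ s.lev x
      have t1 := threat_le x (s.Clash x) us h
      have t2 := threat_le_add x (s.Clash x) us h
      rw [threat_ins]
      by_cases hu : u = x
      · subst hu
        -- If `u` clashes, its saved amount was already the full budget, whether it becomes pending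
        -- or loses a tie. If it does not clash, it cannot become pending.
        by_cases hc : s.Clash u v
        · simp only [if_true, if_pos hc]
          split_ifs <;> omega
        · simp only [if_true, if_neg hc]
          have : (if s.col u = s.col v then some (if s.stamp v ≤ s.stamp u then u else v)
              else none) ≠ some u := by
            intro h'
            split_ifs at h' with h1 h2
            · exact hc ⟨hne.symm, h1.symm, h2⟩
            · exact hne (by simpa using h'.symm)
          rw [if_neg this]
          omega
      · by_cases hv : v = x
        · subst hv
          by_cases hc : s.Clash v u
          · simp only [if_neg hu, if_true, if_pos hc]
            split_ifs <;> omega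
          · simp only [if_neg hu, if_true, if_neg hc]
            have : (if s.col u = s.col v then some (if s.stamp v ≤ s.stamp u then u else v)
                else none) ≠ some v := by
              intro h'
              split_ifs at h' with h1 h2
              · exact hne (by simpa using h')
              · exact hc ⟨hne, h1, by omega⟩
            rw [if_neg this]
            omega
        · simp only [if_neg hu, if_neg hv]
          have : (if s.col u = s.col v then some (if s.stamp v ≤ s.stamp u then u else v)
              else none) ≠ some x := by
            intro h'
            split_ifs at h' with h1 h2
            · exact hu (by simpa using h')
            · exact hv (by simpa using h')
          rw [if_neg this]
          omega
  obtain ⟨u, v, key⟩ := key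
  have hsum : ∑ x, (910 * (Δ - 3 ^ s.lev x) +
      Config.saved ⟨(s.handle a).1, (s.handle a).2, us⟩ x) ≤
      ∑ x, (910 * (Δ - 3 ^ s.lev x) + Config.saved (⟨s, none, a :: us⟩ : Config V Δ) x) +
        24960 := by
    calc _ ≤ ∑ x, ((910 * (Δ - 3 ^ s.lev x) +
          Config.saved (⟨s, none, a :: us⟩ : Config V Δ) x) +
          ((if u = x then 12480 else 0) + (if v = x then 12480 else 0))) :=
          Finset.sum_le_sum fun x _ => by have := key x; omega
      _ = _ := by
          rw [Finset.sum_add_distrib (f := fun x => 910 * (Δ - 3 ^ s.lev x) + _)]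
          congr 1
          rw [Finset.sum_add_distrib, Finset.sum_ite_eq, Finset.sum_ite_eq]
          simp
  have hst := hF.steps
  unfold Config.weight
  simp only [hF.lev, List.length_cons, Option.isSome_none]
  split_ifs <;> simp at * <;> omega

theorem sum_card_sub_le (f : V → ℕ) :
    ∑ x, (Fintype.card V - f x) ≤ Fintype.card V ^ 2 := by
  calc ∑ x, (Fintype.card V - f x) ≤ ∑ _x : V, Fintype.card V :=
        Finset.sum_le_sum fun x _ => Nat.sub_le _ _
    _ = _ := by rw [Finset.sum_const, Finset.card_univ, smul_eq_mul, sq]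

/-- Each update prepays its own steps and the largest possible potential of the chain of
recolourings that it may start. -/
theorem Config.detWeight_handle (s : Mem V Δ) (a : Update V) (us : List (Update V)) :
    Config.detWeight ⟨(s.handle a).1, (s.handle a).2, us⟩ ≤
      Config.detWeight (⟨s, none, a :: us⟩ : Config V Δ) := by
  have hst := (s.frame_handle a).steps
  have hs := sum_card_sub_le fun x => 3 ^ (s.handle a).1.lev x
  unfold Config.detWeight
  simp only [List.length_cons, mul_add, mul_one, Option.isSome_none]
  split_ifs <;> simp at * <;> omega

/-! ### Recolourings -/

theorem Mem.Records.recolor_spec {E : Finset (V × V)} {s : Mem V Δ} (h : Mem.Records E s)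
    (hsymm : ∀ v w, (v, w) ∈ E → (w, v) ∈ E) (hirr : ∀ v, (v, v) ∉ E)
    (hs : s.seen = fun _ => 0) (x : V) (hdeg : Mem.degree E x ≤ Δ) :
    (∃ s' c, s.recolor x = PMF.pure (s', none) ∧ Mem.Recolored E s s' x 0 c ∧
      s'.steps ≤ s.steps + 60 * 3 ^ s.lev x) ∨
    ∃ (k : ℕ) (P : List (Fin (Δ + 1))) (f : Fin (Δ + 1) → Mem V Δ × Option V)
      (_ : Nonempty (Fin P.length)),
      s.recolor x = (PMF.uniformOfFintype (Fin P.length)).map (fun i => f (P.get i)) ∧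
      P.Nodup ∧ 3 ^ k + 2 ≤ 2 * P.length ∧ s.lev x < k ∧ 3 ^ k ≤ Mem.degree E x ∧
      ∀ c, Mem.Recolored E s (f c).1 x k c ∧ (f c).1.steps ≤ s.steps + 130 * 3 ^ k ∧
        ∀ y, (f c).2 = some y → y ≠ x ∧ s.lev y < k := by
  unfold Mem.recolor
  split_ifs with hphi
  · left
    obtain ⟨c, hR, hst⟩ := (h.tick 1).recolored_detColor hsymm hirr hs x
    refine ⟨_, c, rfl, ⟨hR.1, hR.2, hR.3, hR.4, hR.5, hR.6⟩, hst.trans ?_⟩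
    have e1 : (s.tick 1).phi x = s.phi x := rfl
    have e2 : (s.tick 1).steps = s.steps + 1 := rfl
    have e3 : 3 ^ (s.lev x + 1) = 3 * 3 ^ s.lev x := by ring
    rw [e1, e2]
    omega
  · right
    obtain ⟨k, P, f, hne, h1, h2, h3, h4, h5, h6⟩ :=
      (h.tick 1).randColor_spec hsymm hirr hs (x := x) (not_lt.1 hphi) hdeg
    refine ⟨k, P, f, hne, h1, h2, h3, h4, h5, fun c => ?_⟩
    obtain ⟨hR, hst, hy⟩ := h6 c
    refine ⟨⟨hR.1, hR.2, hR.3, hR.4, hR.5, hR.6⟩, hst.trans ?_, hy⟩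
    have e2 : (s.tick 1).steps = s.steps + 1 := rfl
    have e3 : 0 < 3 ^ k := by positivity
    omega

theorem Config.Inv.recolored {G : SimpleGraph V} {c : Config V Δ} (h : c.Inv G) {s' : Mem V Δ}
    {x : V} {k : ℕ} {d : Fin (Δ + 1)} (hR : Mem.Recolored (pairs G) c.mem s' x k d)
    (hk : 3 ^ k ≤ Δ) (hk' : 3 ^ k ≤ Fintype.card V) (o : Option V) :
    Config.Inv G ⟨s', o, c.todo⟩ := by
  refine ⟨hR.records, hR.seen, fun v => ?_, fun v => ?_, fun v => ?_, h.degree_le, h.todo⟩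
  · simp only [hR.stamp, hR.clock, Function.update_apply]
    have := h.stamp v
    split_ifs <;> omega
  · simp only [hR.lev, Function.update_apply]
    split_ifs
    exacts [hk, h.lev_le v]
  · simp only [hR.lev, Function.update_apply]
    split_ifs
    exacts [hk', h.lev_le_card v]

/-- This is the balance of one call for a given colour `d`, common to both kinds of recolouring. The
bounds `3 ^ lev ≤ Δ` in the invariant and for `k` make the truncated differences exact. -/
theorem Config.Inv.weight_recolored {G : SimpleGraph V} {c : Config V Δ} (h : c.Inv G)
    {s' : Mem V Δ} {x : V} (hx : c.pending = some x) {k : ℕ} {d : Fin (Δ + 1)}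
    (hR : Mem.Recolored (pairs G) c.mem s' x k d) (hk : 3 ^ k ≤ Δ) {m : ℕ}
    (hst : s'.steps ≤ c.mem.steps + m) {o : Option V}
    (ho : ∀ y, o = some y → y ≠ x ∧ c.mem.lev y < k) :
    Config.weight ⟨s', o, c.todo⟩ + 910 * 3 ^ k + 1040 * 3 ^ c.mem.lev x + 60 ≤
      c.weight + m + 910 * 3 ^ c.mem.lev x +
        (if o.isSome then 1040 * 3 ^ (k - 1) + 60 else 0) +
        threat x (fun w => c.mem.col w = d) c.todo (1040 * 3 ^ k) := by
  have hother : ∀ z, z ≠ x → (910 * (Δ - 3 ^ s'.lev z) + Config.saved ⟨s', o, c.todo⟩ z) ≤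
      (910 * (Δ - 3 ^ c.mem.lev z) + c.saved z) +
        if o = some z then 1040 * 3 ^ (k - 1) else 0 := by
    intro z hz
    have hl : s'.lev z = c.mem.lev z := by rw [hR.lev, Function.update_of_ne hz]
    have hpz : c.pending ≠ some z := by rw [hx]; simpa using hz.symm
    unfold Config.saved
    simp only [hl, if_neg hpz]
    split_ifs with hoz
    · have hlt := (ho z hoz).2
      have : 3 ^ c.mem.lev z ≤ 3 ^ (k - 1) := Nat.pow_le_pow_right (by norm_num) (by omega)
      omega
    · have : threat z (s'.Clash z) c.todo (1040 * 3 ^ c.mem.lev z) ≤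
          threat z (c.mem.Clash z) c.todo (1040 * 3 ^ c.mem.lev z) := by
        refine threat_mono z (fun w hw => ?_) _ _
        obtain ⟨h1, h2, h3⟩ := hw
        rw [hR.stamp, Function.update_of_ne hz] at h3
        have hwx : w ≠ x := by
          rintro rfl
          rw [Function.update_self] at h3
          have := h.stamp z
          omega
        rw [Function.update_of_ne hwx] at h3
        rw [hR.col, Function.update_of_ne hz, Function.update_of_ne hwx] at h2
        exact ⟨h1, h2, h3⟩
      omega
  have hself : Config.saved ⟨s', o, c.todo⟩ x ≤
      threat x (fun w => c.mem.col w = d) c.todo (1040 * 3 ^ k) := by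
    have hox : o ≠ some x := fun h' => (ho x h').1 rfl
    unfold Config.saved
    have hl : s'.lev x = k := by rw [hR.lev, Function.update_self]
    simp only [if_neg hox, hl]
    refine threat_mono x (fun w hw => ?_) _ _
    obtain ⟨h1, h2, _⟩ := hw
    rwa [hR.col, Function.update_of_ne h1, Function.update_self] at h2
  have hsum : ∑ z ∈ Finset.univ.erase x,
      (910 * (Δ - 3 ^ s'.lev z) + Config.saved ⟨s', o, c.todo⟩ z) ≤
      ∑ z ∈ Finset.univ.erase x, (910 * (Δ - 3 ^ c.mem.lev z) + c.saved z) +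
        if o.isSome then 1040 * 3 ^ (k - 1) else 0 := by
    refine (Finset.sum_le_sum fun z hz => hother z (Finset.ne_of_mem_erase hz)).trans ?_
    rw [Finset.sum_add_distrib]
    refine Nat.add_le_add_left ?_ _
    cases o with
    | none => simp
    | some y =>
      simp only [Option.some.injEq, Finset.sum_ite_eq, Option.isSome_some, if_true]
      split_ifs <;> omega
  have hxs : c.saved x = 1040 * 3 ^ c.mem.lev x := by simp [Config.saved, hx]
  have hl : s'.lev x = k := by rw [hR.lev, Function.update_self]
  have hlx := h.lev_le x
  unfold Config.weight
  rw [← Finset.add_sum_erase _ _ (Finset.mem_univ x),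
    ← Finset.add_sum_erase (a := x) _ (fun z => 910 * (Δ - 3 ^ c.mem.lev z) + c.saved z)
      (Finset.mem_univ x)]
  simp only [hx, hl, hxs, Option.isSome_some, if_true]
  cases o with
  | none =>
    simp only [Option.isSome_none, Bool.false_eq_true, if_false] at hsum ⊢
    omega
  | some y =>
    simp only [Option.isSome_some, if_true] at hsum ⊢
    omega

/-- Since `3 * 3 ^ lev ≤ 3 ^ k`, the rise releases at least two thirds of `195 * 3 ^ k`, which is
exactly `130 * 3 ^ k`. -/
theorem Config.Inv.detWeight_recolored {G : SimpleGraph V} {c : Config V Δ} (h : c.Inv G)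
    {s' : Mem V Δ} {x : V} (hx : c.pending = some x) {k : ℕ} {d : Fin (Δ + 1)}
    (hR : Mem.Recolored (pairs G) c.mem s' x k d) (hk : 3 ^ k ≤ Fintype.card V)
    (hlt : c.mem.lev x < k) (hst : s'.steps ≤ c.mem.steps + 130 * 3 ^ k) (o : Option V) :
    Config.detWeight ⟨s', o, c.todo⟩ ≤ c.detWeight := by
  have hl : s'.lev x = k := by rw [hR.lev, Function.update_self]
  have hlx := h.lev_le_card x
  have hpow : 3 * 3 ^ c.mem.lev x ≤ 3 ^ k := by
    rw [← pow_succ']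
    exact Nat.pow_le_pow_right (by norm_num) hlt
  have hsum : ∑ z ∈ Finset.univ.erase x, (Fintype.card V - 3 ^ s'.lev z) =
      ∑ z ∈ Finset.univ.erase x, (Fintype.card V - 3 ^ c.mem.lev z) :=
    Finset.sum_congr rfl fun z hz => by
      rw [hR.lev, Function.update_of_ne (Finset.ne_of_mem_erase hz)]
  unfold Config.detWeight
  rw [← Finset.add_sum_erase _ _ (Finset.mem_univ x),
    ← Finset.add_sum_erase (a := x) _ (fun z => Fintype.card V - 3 ^ c.mem.lev z)
      (Finset.mem_univ x)]
  simp only [hx, hl, Option.isSome_some, if_true, hsum]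
  split_ifs <;> omega

theorem Config.next_pending (s : Mem V Δ) (x : V) (us : List (Update V)) :
    Config.next ⟨s, some x, us⟩ = (s.recolor x).map fun p => (⟨p.1, p.2, us⟩ : Config V Δ) := rfl

theorem Config.Inv.next {G : SimpleGraph V} {c : Config V Δ} (h : c.Inv G) :
    (∀ c' ∈ c.next.support, (∃ G', c'.Inv G') ∧ c'.detWeight ≤ c.detWeight) ∧
      ∑' c', c.next c' * (c'.weight : ℝ≥0∞) ≤ c.weight := by
  obtain ⟨s, o, us⟩ := c
  cases o with
  | none =>
    cases us with
    | nil =>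
      refine ⟨fun c' hc' => ?_, ?_⟩
      · obtain rfl : c' = _ := (PMF.mem_support_pure_iff _ _).1 hc'
        exact ⟨⟨G, h⟩, le_rfl⟩
      · exact (tsum_pure_mul _ _).le
    | cons a us =>
      refine ⟨fun c' hc' => ?_, ?_⟩
      · obtain rfl : c' = _ := (PMF.mem_support_pure_iff _ _).1 hc'
        exact ⟨⟨_, h.handle⟩, Config.detWeight_handle s a us⟩
      · refine (tsum_pure_mul _ _).le.trans ?_
        exact_mod_cast Config.weight_handle h.todo.1
  | some x =>
    have hirr : ∀ v, (v, v) ∉ pairs G := fun v => by simp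
    have hcard : 0 < Fintype.card V := Fintype.card_pos_iff.2 ⟨x⟩
    have hlx := h.lev_le x
    have hlc := h.lev_le_card x
    have hpow : 0 < 3 ^ s.lev x := by positivity
    simp only at hlx hlc
    rw [Config.next_pending]
    rcases h.records.recolor_spec (fun v w hvw => by simpa [G.adj_comm] using hvw) hirr h.seen x
      (h.degree_le x) with
      ⟨s', d, hs', hR, hst⟩ | ⟨k, P, f, hne, hf, hP, hPl, hlt, hk, hrec⟩
    · have hs'' : s.recolor x = PMF.pure (s', none) := hs'
      rw [hs'', PMF.pure_map]
      refine ⟨fun c' hc' => ?_, ?_⟩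
      · obtain rfl : c' = _ := (PMF.mem_support_pure_iff _ _).1 hc'
        refine ⟨⟨G, h.recolored hR (by simp only [pow_zero]; omega)
          (by simp only [pow_zero]; omega) none⟩, ?_⟩
        unfold Config.detWeight
        simp only [Option.isSome_none, Option.isSome_some, if_true, Bool.false_eq_true, if_false]
        simp only at hst
        omega
      · refine (tsum_pure_mul _ _).le.trans ?_
        have hw := h.weight_recolored rfl hR (by simp only [pow_zero]; omega) hst (o := none)
          (by simp)
        have ht := threat_le x (fun w => s.col w = d) us (1040 * 3 ^ 0)
        simp only [Option.isSome_none, Bool.false_eq_true, if_false, pow_zero, mul_one] at hw ht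
        -- With `q = 3 ^ s.lev x`, the balance is `60 * q + 910 * q + 1040 ≤ 1040 * q + 910 + 60`,
        -- that is `70 ≤ 70 * q`; it is tight at level zero.
        have : Config.weight ⟨s', none, us⟩ ≤ Config.weight ⟨s, some x, us⟩ := by omega
        exact_mod_cast this
    · have hf' : s.recolor x = _ := hf
      have hkΔ : 3 ^ k ≤ Δ := hk.trans (h.degree_le x)
      have hkc : 3 ^ k ≤ Fintype.card V := hk.trans (degree_lt hirr x).le
      rw [hf', PMF.map_comp]
      refine ⟨fun c' hc' => ?_, ?_⟩
      · rw [PMF.mem_support_map_iff] at hc'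
        obtain ⟨i, _, rfl⟩ := hc'
        obtain ⟨hR, hst, _⟩ := hrec (P.get i)
        exact ⟨⟨G, h.recolored hR hkΔ hkc _⟩, h.detWeight_recolored rfl hR hkc hlt hst _⟩
      · rw [tsum_map_mul]
        refine tsum_uniform_mul_le _ ?_
        simp only [Function.comp_apply, Fintype.card_fin]
        set t : Fin (Δ + 1) → ℕ :=
          fun d => threat x (fun w => s.col w = d) us (1040 * 3 ^ k) with ht
        set W := Config.weight (⟨s, some x, us⟩ : Config V Δ)
        obtain ⟨j, rfl⟩ : ∃ j, k = j + 1 := ⟨k - 1, by omega⟩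
        -- The factor 3 clears the fraction `3 ^ (k - 1)`. Released are `3 * 910`, spent are `3 *
        -- 130` for the steps and `1040` for the next vertex, in units of `3 ^ k`; this leaves
        -- `1300` for the threat.
        have hstep : ∀ d, 3 * Config.weight ⟨(f d).1, (f d).2, us⟩ + 1300 * 3 ^ (j + 1) ≤
            3 * W + 3 * t d := by
          intro d
          obtain ⟨hR, hst, hy⟩ := hrec d
          have hw := h.weight_recolored rfl hR hkΔ hst hy
          have e1 : (if (f d).2.isSome then 1040 * 3 ^ (j + 1 - 1) + 60 else 0) ≤
              1040 * 3 ^ j + 60 := by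
            rw [Nat.add_sub_cancel]
            split_ifs <;> omega
          have e2 : 3 ^ (j + 1) = 3 * 3 ^ j := by ring
          simp only [ht]
          simp only at hw
          omega
        have hsum : ∑ i, t (P.get i) = ∑ d ∈ P.toFinset, t d := by
          rw [← Finset.sum_image (s := Finset.univ) (g := P.get)
            (fun a _ b _ hab => (List.nodup_iff_injective_get.1 hP) hab)]
          congr 1
          ext d
          simp [List.mem_iff_get]
        have hth : 24960 * ∑ i, t (P.get i) ≤ _ := hsum ▸ sum_threat_le x s.col us _ P.toFinset
        -- As `24960 = 24 * 1040`, the bound on the sum reduces this to `3 ^ k + 24 ≤ 10 * |P|`.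
        have hT : 3 * ∑ i, t (P.get i) ≤ P.length * (1300 * 3 ^ (j + 1)) := by
          have e4 : 3 ^ (j + 1) + 24 ≤ 10 * P.length := by
            rw [pow_succ'] at hPl ⊢
            -- At `k = 1` integrality is needed: `2 * |P| ≥ 5` gives `|P| ≥ 3`, hence `10 * |P| ≥
            -- 27`.
            rcases j with _ | j
            · omega
            · have : 0 < 3 ^ j := by positivity
              rw [pow_succ'] at hPl ⊢
              omega
          have e5 := Nat.mul_le_mul_left (3 ^ (j + 1)) e4
          nlinarith
        have hall : ∑ i : Fin P.length,
            Config.weight ⟨(f (P.get i)).1, (f (P.get i)).2, us⟩ ≤ P.length * W := by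
          have := Finset.sum_le_sum fun (i : Fin P.length) (_ : i ∈ Finset.univ) =>
            hstep (P.get i)
          rw [Finset.sum_add_distrib, Finset.sum_add_distrib, ← Finset.mul_sum,
            Finset.sum_const, Finset.sum_const, ← Finset.mul_sum, Finset.card_univ,
            Fintype.card_fin, smul_eq_mul, smul_eq_mul] at this
          linarith
        exact_mod_cast hall

/-! ### The whole run -/

theorem law_support {χ₀ : V → Fin (Δ + 1)} {us : List (Update V)} {G : SimpleGraph V}
    (h : Config.Inv G ⟨Mem.init χ₀, none, us⟩) (k : ℕ) :
    ∀ c ∈ (law χ₀ us k).support, (∃ G', c.Inv G') ∧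
      c.detWeight ≤ Config.detWeight ⟨Mem.init χ₀, none, us⟩ := by
  induction k with
  | zero =>
    intro c hc
    obtain rfl : c = _ := (PMF.mem_support_pure_iff _ _).1 hc
    exact ⟨⟨G, h⟩, le_rfl⟩
  | succ k ih =>
    intro c hc
    obtain ⟨c₀, hc₀, hc⟩ := (PMF.mem_support_bind_iff _ _ _).1 hc
    obtain ⟨⟨G', hG'⟩, hle⟩ := ih c₀ hc₀
    obtain ⟨h1, h2⟩ := hG'.next.1 c hc
    exact ⟨h1, h2.trans hle⟩

/-- The supermartingale inequality of `Config.Inv.next` is averaged over the reachable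
configurations; the others have probability zero and need no invariant. -/
theorem tsum_law_weight_le {χ₀ : V → Fin (Δ + 1)} {us : List (Update V)} {G : SimpleGraph V}
    (h : Config.Inv G ⟨Mem.init χ₀, none, us⟩) (k : ℕ) :
    ∑' c, law χ₀ us k c * (c.weight : ℝ≥0∞) ≤ Config.weight ⟨Mem.init χ₀, none, us⟩ := by
  induction k with
  | zero => exact (tsum_pure_mul _ _).le
  | succ k ih =>
    refine le_trans ?_ ih
    rw [law, tsum_bind_mul]
    refine ENNReal.tsum_le_tsum fun c => ?_
    by_cases hc : law χ₀ us k c = 0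
    · simp [hc]
    · obtain ⟨G', hG'⟩ := (law_support h k c hc).1
      gcongr
      exact hG'.next.2

theorem Config.Inv.init {χ₀ : V → Fin (Δ + 1)} {us : List (Update V)} (hΔ : 0 < Δ)
    (hV : 0 < Fintype.card V) (hus : Admissible Δ ⊥ us) :
    Config.Inv ⊥ ⟨Mem.init χ₀, none, us⟩ := by
  refine ⟨⟨?_, ?_, ?_, ?_, ?_, ?_, ?_⟩, rfl, ?_, ?_, ?_, ?_, hus⟩ <;>
    simp [Mem.init, List.nodup_finRange, Mem.degree] <;> omega

/-! ### Initial potential and numerical bounds -/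

theorem clog_le_log (n : ℕ) : (Nat.clog 3 (n - 1) : ℝ) ≤ Real.log n + 1 := by
  have hlog : 0 ≤ Real.log n := Real.log_natCast_nonneg n
  rcases Nat.lt_or_ge 1 (n - 1) with h | h
  · have h1 : 3 ^ (Nat.clog 3 (n - 1) - 1) < n - 1 := Nat.pow_pred_clog_lt_self (by norm_num) h
    have h2 : ((3 : ℝ) ^ (Nat.clog 3 (n - 1) - 1)) ≤ n := by
      exact_mod_cast h1.le.trans (Nat.sub_le n 1)
    have h3 := Real.log_le_log (by positivity) h2
    rw [Real.log_pow] at h3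
    -- Since `e < 3`, the logarithm to base 3 is at most the natural one.
    have h4 : 1 ≤ Real.log 3 := by
      rw [Real.le_log_iff_exp_le (by norm_num)]
      exact Real.exp_one_lt_d9.le.trans (by norm_num)
    have h5 : (Nat.clog 3 (n - 1) : ℝ) ≤ ((Nat.clog 3 (n - 1) - 1 : ℕ) : ℝ) + 1 := by
      exact_mod_cast (by omega : Nat.clog 3 (n - 1) ≤ Nat.clog 3 (n - 1) - 1 + 1)
    have h6 : (0 : ℝ) ≤ ((Nat.clog 3 (n - 1) - 1 : ℕ) : ℝ) := Nat.cast_nonneg _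
    nlinarith
  · rw [Nat.clog_of_right_le_one h]
    simp only [Nat.cast_zero]
    linarith

theorem steps_init_le (n : ℕ) (hn : 0 < n) (hΔ : 0 < Δ) (χ₀ : Fin n → Fin (Δ + 1)) :
    ((Mem.init χ₀).steps : ℝ) ≤ n * Real.log n + 15 * (Δ * n) := by
  have h1 := clog_le_log n
  have hn' : (1 : ℝ) ≤ n := by exact_mod_cast hn
  have hΔ' : (1 : ℝ) ≤ Δ := by exact_mod_cast hΔ
  simp only [Mem.init, numLevels, Fintype.card_fin]
  push_cast
  have h2 : (n : ℝ) * Nat.clog 3 (n - 1) ≤ n * (Real.log n + 1) := by gcongr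
  nlinarith [mul_nonneg (sub_nonneg.2 hn') (sub_nonneg.2 hΔ')]

theorem Config.weight_init_le (n : ℕ) (hΔ : 0 < Δ) (χ₀ : Fin n → Fin (Δ + 1))
    (us : List (Update (Fin n))) :
    Config.weight ⟨Mem.init χ₀, none, us⟩ ≤
      (Mem.init χ₀).steps + 1950 * (Δ * n) + 25027 * us.length := by
  have h : ∀ x, 910 * (Δ - 3 ^ (Mem.init χ₀).lev x) +
      Config.saved ⟨Mem.init χ₀, none, us⟩ x ≤ 1950 * Δ := by
    intro x
    have h1 := threat_le x ((Mem.init χ₀).Clash x) us (1040 * 3 ^ (Mem.init χ₀).lev x)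
    have h2 : (Mem.init χ₀).lev x = 0 := rfl
    simp only [Config.saved, reduceCtorEq, if_false, h2, pow_zero, mul_one] at h1 ⊢
    omega
  have h3 := Finset.sum_le_sum fun x (_ : x ∈ Finset.univ) => h x
  rw [Finset.sum_const, Finset.card_univ, Fintype.card_fin, smul_eq_mul] at h3
  unfold Config.weight
  simp only [Option.isSome_none, Bool.false_eq_true, if_false]
  have h4 : n * (1950 * Δ) = 1950 * (Δ * n) := by ring
  omega

end DynColor

theorem mainTheorem3 :
    ∃ C : ℝ, ∀ (n Δ : ℕ), 0 < n → 0 < Δ →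
      ∀ (χ₀ : Fin n → Fin (Δ + 1)) (us : List (DynColor.Update (Fin n))),
        DynColor.Admissible Δ ⊥ us →
          DynColor.expectedTime χ₀ us ≤
              ENNReal.ofReal (C * ((us.length : ℝ) + n * Real.log n + Δ * n)) ∧
            ∀ (k : ℕ), ∀ c ∈ (DynColor.law χ₀ us k).support,
              (c.mem.steps : ℝ) ≤
                C * ((us.length : ℝ) * (n : ℝ) ^ 2 + n * Real.log n + Δ * n) := by
  -- The largest coefficient is `25027`, the price of an update in `Config.weight`.
  refine ⟨26000, fun n Δ hn hΔ χ₀ us hus => ?_⟩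
  have hinv := DynColor.Config.Inv.init (χ₀ := χ₀) hΔ (by simpa using hn) hus
  have hsteps := DynColor.steps_init_le n hn hΔ χ₀
  have hlog : 0 ≤ n * Real.log n := mul_nonneg (Nat.cast_nonneg n) (Real.log_natCast_nonneg n)
  have hΔn : (0 : ℝ) ≤ Δ * n := by positivity
  have ht : (0 : ℝ) ≤ us.length := Nat.cast_nonneg _
  refine ⟨iSup_le fun k => ?_, fun k c hc => ?_⟩
  · calc ∑' c, DynColor.law χ₀ us k c * (c.mem.steps : ℝ≥0∞)
        ≤ ∑' c, DynColor.law χ₀ us k c * (c.weight : ℝ≥0∞) := by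
          refine ENNReal.tsum_le_tsum fun c => ?_
          gcongr
          unfold DynColor.Config.weight
          omega
      _ ≤ DynColor.Config.weight ⟨DynColor.Mem.init χ₀, none, us⟩ :=
          DynColor.tsum_law_weight_le hinv k
      _ = ENNReal.ofReal
          ((DynColor.Config.weight ⟨DynColor.Mem.init χ₀, none, us⟩ : ℕ) : ℝ) := by
          rw [ENNReal.ofReal_natCast]
      _ ≤ _ := by
          refine ENNReal.ofReal_le_ofReal ?_
          have h1 : ((DynColor.Config.weight ⟨DynColor.Mem.init χ₀, none, us⟩ : ℕ) : ℝ) ≤ _ :=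
            Nat.cast_le.2 (DynColor.Config.weight_init_le n hΔ χ₀ us)
          push_cast at h1
          linarith
  · have h1 : c.mem.steps ≤ c.detWeight := by unfold DynColor.Config.detWeight; omega
    have h2 := h1.trans (DynColor.law_support hinv k c hc).2
    have h3 : (c.mem.steps : ℝ) ≤ _ := Nat.cast_le.2 h2
    simp only [DynColor.Config.detWeight, Option.isSome_none, Bool.false_eq_true, if_false,
      Fintype.card_fin] at h3
    push_cast at h3
    have hn' : (1 : ℝ) ≤ n := by exact_mod_cast hn
    -- Here `262 = 7 + 60 + 195`, using `1 ≤ n`.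
    have h4 : (7 + 60 * (n : ℝ) + 195 * (n : ℝ) ^ 2) * us.length ≤
        262 * (n : ℝ) ^ 2 * us.length := by
      gcongr
      nlinarith
    have h5 : 0 ≤ (us.length : ℝ) * (n : ℝ) ^ 2 := by positivity
    linarith
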